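/- Let $A\in\mathbb{R}^{n\times n}$ and $b,c\in\mathbb{R}^n$ with $(A,b)$ controllable, let $\Omega\subset\mathbb{R}^n$ be compact and convex, $\theta\in\Omega$, and let $r:[0,\infty)\to\mathbb{R}$ be bounded and continuous. Consider the plant $$\dot x(t)=Ax(t)+b\,(u(t)-\theta^\top x(t)),\qquad x(0)=x_0 .$$ Let $K\in\mathbb{R}^n$ be such that $A_m=A-bK^\top$ is Hurwitz, put $H_o(s)=(sI-A_m)^{-1}b$, assume $c^\top H_o(0)\neq 0$ and put $k_g=1/(c^\top H_o(0))$. Let $C(s)$ be a stable strictly proper rational transfer function with $C(0)=1$, let $Q$ be symmetric positive definite, let $P$ solve $A_m^\top P+PA_m=-Q$, and let $\Gamma_c>0$. The $\mathcal{L}_1$ adaptive controller is $$u(t)=-K^\top x(t)+u_2(t),\qquad u_2(s)=C(s)\big(\bar r(s)+k_g r(s)\big),\qquad \bar r(t)=\hat\theta(t)^\top x(t),$$ $$\dot{\hat x}(t)=A_m\hat x(t)-b\,\hat\theta(t)^\top x(t)+b\,u_2(t),\qquad \hat x(0)=x_0,$$ $$\dot{\hat\theta}(t)=\Gamma_c\,\mathrm{Proj}\big(\hat\theta(t),\,x(t)\,(\hat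 x(t)-x(t))^\top Pb\big),\qquad \hat\theta(0)=\hat\theta_0\in\Omega .$$ Here $\mathrm{Proj}(\vartheta,y)$ is the Euclidean projection of $y$ onto the closed convex cone generated by $\Omega-\vartheta$ (the tangent cone of $\Omega$ at $\vartheta$ if $\vartheta\in\Omega$), the last equation is understood in the sense of Carathéodory ($\hat\theta$ is locally absolutely continuous and the equation holds for almost every $t$), and multiplication by $C(s)$ denotes the response of $C$, started at rest, that is, convolution with its impulse response. Assume the $\mathcal{L}_1$-gain requirement $$\|\bar G(s)\|_{\mathcal{L}_1}\,\theta_{\max}<1,\qquad \bar G(s)=H_o(s)(C(s)-1),\qquad \theta_{\max}=\max_{\vartheta\in\Omega}\sum_{i=1}^n|\vartheta_i| ,$$ where $\|\bar G(s)\|_{\mathcal{L}_1}=\max_i\int_0^\infty|\bar g_i(t)|\,dt$ and $\bar g$ is the impulse response of $\bar G$. Let $x,\hat x,\hat\theta,u,u_2$ be a solution of this closed loop on $[0,\infty)$, and let $x_{ref},u_{ref}$ be a solution on $[0,\infty)$, with any initial state $x_{ref}(0)$, of the nonadaptive reference system $$\dot x_{ref}(t)=Ax_{ref}(t)+b\,(u_{ref}(t)-\theta^\top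 x_{ref}(t)),\qquad u_{ref}(s)=C(s)\big(k_g r(s)+\eta(s)\big)-K^\top x_{ref}(s),\qquad \eta(t)=\theta^\top x_{ref}(t).$$ Then $$\lim_{t\to\infty}\|x(t)-x_{ref}(t)\|=0\qquad\text{and}\qquad \lim_{t\to\infty}|u(t)-u_{ref}(t)|=0 .$$ -/

import Mathlib

open Set Filter Topology MeasureTheory
open scoped Matrix ENNReal

noncomputable section

namespace L1Adaptive

/-- A real square matrix is Hurwitz if all its (complex) eigenvalues have negative real part. -/
def IsHurwitz {n : ℕ} (A : Matrix (Fin n) (Fin n) ℝ) : Prop :=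
  ∀ z ∈ spectrum ℂ (A.map (algebraMap ℝ ℂ)), z.re < 0

/-- Controllability of the pair `(A, b)` (Kalman): the vectors `b, A b, …, A ^ (n - 1) b`
span `ℝⁿ`. -/
def IsControllable {n : ℕ} (A : Matrix (Fin n) (Fin n) ℝ) (b : Fin n → ℝ) : Prop :=
  Submodule.span ℝ (range fun k : Fin n => (A ^ (k : ℕ)) *ᵥ b) = ⊤

/-- The impulse response `t ↦ exp (t A) b` of the single-input, `n`-output strictly proper
system `(s I - A)⁻¹ b`. -/
def stateImpulse {n : ℕ} (A : Matrix (Fin n) (Fin n) ℝ) (b : Fin n → ℝ) (t : ℝ) : Fin n → ℝ :=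
  NormedSpace.exp (t • A) *ᵥ b

/-- The transfer function `s ↦ cᵀ (s I - A)⁻¹ b` (at real arguments). -/
def transferFn {n : ℕ} (A : Matrix (Fin n) (Fin n) ℝ) (b c : Fin n → ℝ) (s : ℝ) : ℝ :=
  c ⬝ᵥ ((s • (1 : Matrix (Fin n) (Fin n) ℝ) - A)⁻¹ *ᵥ b)

/-- A single-input single-output strictly proper LTI system of finite order, given by a
state-space realization; its transfer function is `cᵀ (s I - A)⁻¹ b`. -/
structure StrictlyProperSystem where
  /-- the order of the realization -/
  order : ℕ
  /-- the state matrix -/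
  A : Matrix (Fin order) (Fin order) ℝ
  /-- the input vector -/
  b : Fin order → ℝ
  /-- the output vector -/
  c : Fin order → ℝ

namespace StrictlyProperSystem

/-- Stability. Every strictly proper rational transfer function with poles in the open left half
plane has a realization that is stable in this sense, and conversely. -/
def Stable (C : StrictlyProperSystem) : Prop := IsHurwitz C.A

/-- The transfer function `C(s)`. -/
def transfer (C : StrictlyProperSystem) (s : ℝ) : ℝ := transferFn C.A C.b C.c s

/-- The impulse response of `C(s)`. -/
def impulse (C : StrictlyProperSystem) (t : ℝ) : ℝ := C.c ⬝ᵥ stateImpulse C.A C.b t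

/-- The signal with Laplace transform `C(s) v(s)`: the response of the system, started at rest,
to the input `v`. -/
def response (C : StrictlyProperSystem) (v : ℝ → ℝ) (t : ℝ) : ℝ :=
  ∫ τ in (0 : ℝ)..t, C.impulse (t - τ) * v τ

end StrictlyProperSystem

/-- The `L₁` gain of a single-input, `n`-output system with impulse response `g`:
`max_i ∫₀^∞ |g_i(t)| dt`. -/
def l1Gain {n : ℕ} (g : ℝ → Fin n → ℝ) : ℝ≥0∞ :=
  ⨆ i, ∫⁻ t in Ioi (0 : ℝ), ‖g t i‖ₑ

/-- The impulse response of `Ḡ(s) = H_o(s) (C(s) - 1)`, where `H_o(s) = (s I - A_m)⁻¹ b`. -/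
def gBar {n : ℕ} (Am : Matrix (Fin n) (Fin n) ℝ) (b : Fin n → ℝ) (C : StrictlyProperSystem)
    (t : ℝ) : Fin n → ℝ :=
  fun i => (∫ τ in (0 : ℝ)..t, stateImpulse Am b (t - τ) i * C.impulse τ) - stateImpulse Am b t i

/-- `θ_max = max_{θ ∈ Ω} ∑ i, |θ i|`. -/
def thetaMax {n : ℕ} (Ω : Set (Fin n → ℝ)) : ℝ :=
  sSup ((fun θ : Fin n → ℝ => ∑ i, |θ i|) '' Ω)

/-- `A_m = A - b Kᵀ`. -/
def closedMatrix {n : ℕ} (A : Matrix (Fin n) (Fin n) ℝ) (b K : Fin n → ℝ) :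
    Matrix (Fin n) (Fin n) ℝ :=
  A - Matrix.vecMulVec b K

/-- `k_g = 1 / (cᵀ H_o(0))`. -/
def kg {n : ℕ} (Am : Matrix (Fin n) (Fin n) ℝ) (b c : Fin n → ℝ) : ℝ :=
  1 / transferFn Am b c 0

/-- The closed cone of directions from `θ` into `Ω`. For `Ω` convex and `θ ∈ Ω` this is the
tangent cone of `Ω` at `θ`; in the interior of `Ω` it is the whole space. -/
def dirCone {n : ℕ} (Ω : Set (Fin n → ℝ)) (θ : Fin n → ℝ) : Set (Fin n → ℝ) :=
  closure {v | ∃ z ∈ Ω, ∃ a : ℝ, 0 ≤ a ∧ v = a • (z - θ)}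

/-- `p` is a point of `S` at the least Euclidean distance from `y`. -/
def IsNearest {n : ℕ} (S : Set (Fin n → ℝ)) (y p : Fin n → ℝ) : Prop :=
  p ∈ S ∧ ∀ v ∈ S, (y - p) ⬝ᵥ (y - p) ≤ (y - v) ⬝ᵥ (y - v)

/-- The projection operator `Proj(θ, y)` of adaptive control for the convex set `Ω`: the
Euclidean projection of the nominal update direction `y` onto the tangent cone of `Ω` at `θ`.
It equals `y` in the interior of `Ω` and removes the outward normal component of `y` on the
boundary. -/
def Proj {n : ℕ} (Ω : Set (Fin n → ℝ)) (θ y : Fin n → ℝ) : Fin n → ℝ :=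
  Classical.epsilon (IsNearest (dirCone Ω θ) y)

/-- The nearest point in the definition of `Proj` exists and is unique. -/
theorem existsUnique_isNearest {n : ℕ} {Ω : Set (Fin n → ℝ)} (hΩ : Convex ℝ Ω)
    (hne : Ω.Nonempty) (θ y : Fin n → ℝ) : ∃! p, IsNearest (dirCone Ω θ) y p := by
  have key : ∀ v : Fin n → ℝ,
      v ⬝ᵥ v = dist (WithLp.toLp 2 v : EuclideanSpace ℝ (Fin n)) 0 ^ 2 := by
    intro v
    rw [dist_zero_right, EuclideanSpace.norm_sq_eq]
    simp [dotProduct, sq]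
  have hd : ∀ v w : Fin n → ℝ, (v - w) ⬝ᵥ (v - w) =
      dist (WithLp.toLp 2 v : EuclideanSpace ℝ (Fin n)) (WithLp.toLp 2 w) ^ 2 := by
    intro v w
    rw [key, dist_zero_right, dist_eq_norm, WithLp.toLp_sub]
  have hcl : IsClosed (dirCone Ω θ) := isClosed_closure
  have hcv : Convex ℝ (dirCone Ω θ) := by
    refine Convex.closure ?_
    rintro _ ⟨z, hz, a, ha, rfl⟩ _ ⟨w, hw, b, hb, rfl⟩ s t hs ht -
    rcases (add_nonneg (mul_nonneg hs ha) (mul_nonneg ht hb)).eq_or_lt with h0 | hpos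
    · have h1 : s * a = 0 := by nlinarith [mul_nonneg hs ha, mul_nonneg ht hb]
      have h2 : t * b = 0 := by nlinarith [mul_nonneg hs ha, mul_nonneg ht hb]
      exact ⟨z, hz, 0, le_rfl, by simp [smul_smul, h1, h2]⟩
    · refine ⟨(s * a / (s * a + t * b)) • z + (t * b / (s * a + t * b)) • w,
        hΩ hz hw (by positivity) (by positivity) (by field_simp), s * a + t * b, hpos.le, ?_⟩
      ext i
      simp only [Pi.add_apply, Pi.smul_apply, Pi.sub_apply, smul_eq_mul]
      field_simp
      ring
  have hn : (dirCone Ω θ).Nonempty := by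
    obtain ⟨z, hz⟩ := hne
    exact ⟨0, subset_closure ⟨z, hz, 0, le_rfl, by simp⟩⟩
  have hcl' : IsClosed ((WithLp.ofLp : EuclideanSpace ℝ (Fin n) → (Fin n → ℝ)) ⁻¹' dirCone Ω θ) :=
    hcl.preimage (by fun_prop)
  obtain ⟨p, hp, hpd⟩ := hcl'.exists_infDist_eq_dist
    (by obtain ⟨v, hv⟩ := hn; exact ⟨WithLp.toLp 2 v, hv⟩) (WithLp.toLp 2 y)
  have hP : IsNearest (dirCone Ω θ) y p.ofLp := by
    refine ⟨hp, fun v hv => ?_⟩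
    rw [hd, hd]
    have : dist (WithLp.toLp 2 y) p ≤ dist (WithLp.toLp 2 y) (WithLp.toLp 2 v) := by
      rw [← hpd]
      exact Metric.infDist_le_dist_of_mem hv
    exact pow_le_pow_left₀ dist_nonneg this 2
  refine ⟨_, hP, fun q hq => ?_⟩
  set p' := p.ofLp
  have hm := hP.2 _ (hcv hP.1 hq.1 (a := 1 / 2) (b := 1 / 2) (by norm_num) (by norm_num)
    (by norm_num))
  have h2 := hq.2 _ hP.1
  have e1 : y - ((1 / 2 : ℝ) • p' + (1 / 2 : ℝ) • q)
      = (1 / 2 : ℝ) • (y - p') + (1 / 2 : ℝ) • (y - q) := by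
    ext i; simp; ring
  have e2 : q - p' = (y - p') - (y - q) := by ext i; simp
  have h3 : (q - p') ⬝ᵥ (q - p') ≤ 0 := by
    rw [e1] at hm
    rw [e2]
    simp only [dotProduct_add, add_dotProduct, dotProduct_smul, smul_dotProduct, smul_eq_mul,
      dotProduct_sub (y - p') , dotProduct_sub (y - q),
      sub_dotProduct (y - p') (y - q)] at hm ⊢
    have hc : (y - q) ⬝ᵥ (y - p') = (y - p') ⬝ᵥ (y - q) := dotProduct_comm _ _
    simp only [dotProduct_sub, sub_dotProduct] at hm h2 hc ⊢
    linarith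
  have h4 : (q - p') ⬝ᵥ (q - p') = 0 := le_antisymm h3 (by
    simp only [dotProduct]; exact Finset.sum_nonneg fun i _ => mul_self_nonneg _)
  exact sub_eq_zero.1 (dotProduct_self_eq_zero.1 h4)

/-- The defining property of `Proj`. -/
theorem isNearest_proj {n : ℕ} {Ω : Set (Fin n → ℝ)} (hΩ : Convex ℝ Ω) (hne : Ω.Nonempty)
    (θ y : Fin n → ℝ) : IsNearest (dirCone Ω θ) y (Proj Ω θ y) :=
  Classical.epsilon_spec (existsUnique_isNearest hΩ hne θ y).exists

/-- The plant `x' = A x + b (u - θᵀ x)` on `[0, ∞)`. -/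
def IsPlantTrajectory {n : ℕ} (A : Matrix (Fin n) (Fin n) ℝ) (b θ : Fin n → ℝ)
    (u : ℝ → ℝ) (x : ℝ → Fin n → ℝ) : Prop :=
  ∀ t, 0 ≤ t → HasDerivWithinAt x (A *ᵥ x t + (u t - θ ⬝ᵥ x t) • b) (Ici 0) t

/-- The closed loop of the plant with the `L₁` adaptive controller; the variables are the plant
state `x`, the predictor state `xh`, the parameter estimate `θh`, the control `u` and its adaptive
part `u₂`. -/
structure IsAdaptiveClosedLoop {n : ℕ} (A : Matrix (Fin n) (Fin n) ℝ) (b c K θ : Fin n → ℝ)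
    (Ω : Set (Fin n → ℝ)) (C : StrictlyProperSystem) (P : Matrix (Fin n) (Fin n) ℝ) (Γc : ℝ)
    (r : ℝ → ℝ) (x₀ θh₀ : Fin n → ℝ)
    (x xh θh : ℝ → Fin n → ℝ) (u u₂ : ℝ → ℝ) : Prop where
  /-- the plant -/
  plant : IsPlantTrajectory A b θ u x
  plant_init : x 0 = x₀
  /-- the control law `u = -Kᵀ x + u₂` -/
  control : ∀ t, 0 ≤ t → u t = -(K ⬝ᵥ x t) + u₂ t
  /-- the state predictor `x̂' = A_m x̂ - b θ̂ᵀ x + b u₂` -/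
  predictor : ∀ t, 0 ≤ t → HasDerivWithinAt xh
    (closedMatrix A b K *ᵥ xh t - (θh t ⬝ᵥ x t) • b + u₂ t • b) (Ici 0) t
  predictor_init : xh 0 = x₀
  /-- the adaptive law `θ̂' = Γ Proj(θ̂, x x̃ᵀ P b)`, `x̃ = x̂ - x`, `Γ = Γ_c I`; since `Proj` is
  discontinuous, solutions are understood in the sense of Carathéodory -/
  estimate_ac : ∀ T, 0 ≤ T → AbsolutelyContinuousOnInterval θh 0 T
  estimate : ∀ᵐ t, 0 < t →
    HasDerivAt θh (Γc • Proj Ω (θh t) (((xh t - x t) ⬝ᵥ (P *ᵥ b)) • x t)) t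
  estimate_init : θh 0 = θh₀
  /-- the filter `u₂(s) = C(s) (r̄(s) + k_g r(s))`, `r̄ = θ̂ᵀ x` -/
  filter : ∀ t, 0 ≤ t →
    u₂ t = C.response (fun τ => θh τ ⬝ᵥ x τ + kg (closedMatrix A b K) b c * r τ) t

/-- The nonadaptive closed-loop reference system: the plant with the control
`u_ref(s) = C(s) (k_g r(s) + η(s)) - Kᵀ x_ref(s)`, `η = θᵀ x_ref`. -/
structure IsReferenceClosedLoop {n : ℕ} (A : Matrix (Fin n) (Fin n) ℝ) (b c K θ : Fin n → ℝ)
    (C : StrictlyProperSystem) (r : ℝ → ℝ) (xref : ℝ → Fin n → ℝ) (uref : ℝ → ℝ) : Prop where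
  plant : IsPlantTrajectory A b θ uref xref
  control : ∀ t, 0 ≤ t → uref t =
    C.response (fun τ => kg (closedMatrix A b K) b c * r τ + θ ⬝ᵥ xref τ) t - K ⬝ᵥ xref t

end L1Adaptive

end

/-!
Write `e = x̂ - x`, `q = (θ̂ - θ)ᵀ x`, `y = x - x_ref` and let `h` be the impulse response of `C`.

The projected adaptive law keeps `θ̂` in `Ω` and makes `eᵀ P e + |θ̂ - θ|² / Γ_c` decrease at the
rate `eᵀ Q e` at least, so `e` is bounded and `eᵀ Q e` is integrable. The predictor is driven by
`θ̂ᵀ x` through `Ḡ`; the gain requirement and the boundedness of `e` therefore bound `x`, and then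
`e → 0` by Barbalat's argument. Since `e' = A_m e - q b`, the signal `q` is, up to vanishing terms,
a derivative of a vanishing signal; `C` being strictly proper, `h * q → 0`. Finally `y` satisfies
`y' = A_m y + (h * θᵀ y - θᵀ y + h * q) b`, that is, `θᵀ y` acts on `y` through `Ḡ` and the
perturbation `h * q` vanishes, so the gain requirement forces `y → 0`.
-/

noncomputable section

namespace L1Adaptive

section MatrixExponential

open scoped Matrix.Norms.Frobenius

variable {ι : Type*} [Fintype ι] [DecidableEq ι]

theorem pow_mulVec_of_mulVec_eq_smul {R : Type*} [CommSemiring R] {A : Matrix ι ι R} {z : R}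
    {v : ι → R} (h : A *ᵥ v = z • v) (k : ℕ) : A ^ k *ᵥ v = z ^ k • v := by
  induction k with
  | zero => simp
  | succ k ih =>
    rw [pow_succ, ← Matrix.mulVec_mulVec, h, Matrix.mulVec_smul, ih, smul_smul, pow_succ']

theorem exp_mulVec_of_mulVec_eq_smul {𝕜 : Type*} [RCLike 𝕜] {A : Matrix ι ι 𝕜} {z : 𝕜}
    {v : ι → 𝕜} (h : A *ᵥ v = z • v) : NormedSpace.exp A *ᵥ v = NormedSpace.exp z • v := by
  have hA := (NormedSpace.exp_series_hasSum_exp' (𝕂 := 𝕜) A).mapL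
    (LinearMap.toContinuousLinearMap ((Matrix.mulVecBilin 𝕜 𝕜).flip v))
  have hz := (NormedSpace.exp_series_hasSum_exp' (𝕂 := 𝕜) z).smul_const v
  refine hA.unique (hz.congr_fun ?_)
  intro k
  change ((k.factorial : 𝕜)⁻¹ • A ^ k) *ᵥ v = _
  rw [Matrix.smul_mulVec, pow_mulVec_of_mulVec_eq_smul h, smul_smul, smul_eq_mul]

-- `A` preserves each eigenspace of `exp A`, hence has an eigenvector in it.
theorem exists_exp_eq_of_mem_spectrum_exp {A : Matrix ι ι ℂ} {μ : ℂ}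
    (hμ : μ ∈ spectrum ℂ (NormedSpace.exp A)) : ∃ z ∈ spectrum ℂ A, Complex.exp z = μ := by
  rw [← Matrix.spectrum_toLin', ← Module.End.hasEigenvalue_iff_mem_spectrum] at hμ
  have hcomm : Commute (Matrix.toLin' (NormedSpace.exp A)) (Matrix.toLin' A) :=
    (Commute.refl A).exp_left.map (Matrix.toLinAlgEquiv' (R := ℂ) (n := ι))
  have hmaps := Module.End.mapsTo_genEigenspace_of_comm hcomm μ 1
  have : Nontrivial (Module.End.eigenspace (Matrix.toLin' (NormedSpace.exp A)) μ) :=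
    Submodule.nontrivial_iff_ne_bot.2 hμ
  obtain ⟨z, hz⟩ := Module.End.exists_eigenvalue ((Matrix.toLin' A).restrict hmaps)
  obtain ⟨w, hw⟩ := hz.exists_hasEigenvector
  have hw0 : (w : ι → ℂ) ≠ 0 := fun h => hw.2 (Subtype.ext h)
  have hAw : A *ᵥ (w : ι → ℂ) = z • (w : ι → ℂ) := congrArg Subtype.val hw.apply_eq_smul
  have hexp : NormedSpace.exp A *ᵥ (w : ι → ℂ) = μ • (w : ι → ℂ) :=
    Module.End.mem_eigenspace_iff.1 w.2
  refine ⟨z, ?_, ?_⟩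
  · rw [← Matrix.spectrum_toLin', ← Module.End.hasEigenvalue_iff_mem_spectrum]
    exact Module.End.hasEigenvalue_of_hasEigenvector ⟨Module.End.mem_eigenspace_iff.2 hAw, hw0⟩
  · rw [Complex.exp_eq_exp_ℂ]
    exact smul_left_injective ℂ hw0 ((exp_mulVec_of_mulVec_eq_smul hAw).symm.trans hexp)

theorem spectralRadius_exp_lt_one {A : Matrix ι ι ℂ} [Nonempty ι]
    (hA : ∀ z ∈ spectrum ℂ A, z.re < 0) : spectralRadius ℂ (NormedSpace.exp A) < 1 := by
  refine spectrum.spectralRadius_lt_of_forall_lt (r := 1) _ fun μ hμ => ?_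
  obtain ⟨z, hz, rfl⟩ := exists_exp_eq_of_mem_spectrum_exp hμ
  rw [← NNReal.coe_lt_coe, coe_nnnorm, Complex.norm_exp, NNReal.coe_one, Real.exp_lt_one_iff]
  exact hA z hz

theorem hasDerivAt_exp_smul_mulVec (A : Matrix ι ι ℝ) (v : ι → ℝ) (t : ℝ) :
    HasDerivAt (fun s : ℝ => NormedSpace.exp (s • A) *ᵥ v)
      (A *ᵥ (NormedSpace.exp (t • A) *ᵥ v)) t := by
  rw [Matrix.mulVec_mulVec]
  exact (LinearMap.toContinuousLinearMap
    ((Matrix.mulVecBilin ℝ ℝ).flip v)).hasFDerivAt.comp_hasDerivAt t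
      (hasDerivAt_exp_smul_const' (𝕂 := ℝ) A t)

end MatrixExponential

theorem exists_norm_pow_lt_one_of_spectralRadius_lt_one {R : Type*} [NormedRing R]
    [NormedAlgebra ℂ R] [CompleteSpace R] {a : R} (ha : spectralRadius ℂ a < 1) :
    ∃ k : ℕ, 0 < k ∧ ‖a ^ k‖ < 1 := by
  have hroot := (spectrum.pow_nnnorm_pow_one_div_tendsto_nhds_spectralRadius a).eventually_lt_const
    ha
  obtain ⟨k, hk, hlt⟩ := ((eventually_gt_atTop 0).and hroot).exists
  refine ⟨k, hk, ?_⟩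
  contrapose! hlt
  exact ENNReal.one_le_rpow (by exact_mod_cast hlt) (by positivity)

theorem norm_map_nsmul_add_le {R : Type*} [NormedRing R] {F : ℝ → R}
    (hF : ∀ s t, 0 ≤ s → 0 ≤ t → F (s + t) = F s * F t) {T : ℝ} (hT : 0 ≤ T) (m : ℕ) {s : ℝ}
    (hs : 0 ≤ s) : ‖F (m * T + s)‖ ≤ ‖F T‖ ^ m * ‖F s‖ := by
  induction m with
  | zero => simp
  | succ m ih =>
    have hsplit : ((m + 1 : ℕ) : ℝ) * T + s = T + (m * T + s) := by push_cast; ring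
    rw [hsplit, hF _ _ hT (by positivity), pow_succ', mul_assoc]
    exact (norm_mul_le _ _).trans (by gcongr)

theorem pow_floor_div_le_exp {q T t : ℝ} (hq0 : 0 < q) (hq1 : q < 1) :
    q ^ ⌊t / T⌋₊ ≤ q⁻¹ * Real.exp (-(-Real.log q / T) * t) := by
  have hfloor : t / T ≤ ⌊t / T⌋₊ + 1 := (Nat.lt_floor_add_one _).le
  calc q ^ ⌊t / T⌋₊ = q⁻¹ * Real.exp (Real.log q * (⌊t / T⌋₊ + 1)) := by
        rw [mul_add_one, Real.exp_add, mul_comm (Real.log q), Real.exp_nat_mul, Real.exp_log hq0]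
        field_simp
    _ ≤ q⁻¹ * Real.exp (Real.log q * (t / T)) := by
        gcongr q⁻¹ * Real.exp ?_
        exact mul_le_mul_of_nonpos_left hfloor (Real.log_neg hq0 hq1).le
    _ = q⁻¹ * Real.exp (-(-Real.log q / T) * t) := by ring_nf

theorem exists_isBigO_exp_neg_of_map_add {R : Type*} [NormedRing R] {F : ℝ → R}
    (hF : ∀ s t, 0 ≤ s → 0 ≤ t → F (s + t) = F s * F t) {T : ℝ} (hT : 0 < T)
    (hcont : ContinuousOn F (Icc 0 T)) (hlt : ‖F T‖ < 1) :
    ∃ l > 0, F =O[atTop] fun t => Real.exp (-l * t) := by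
  obtain ⟨M, hM⟩ := isCompact_Icc.exists_bound_of_continuousOn hcont
  obtain ⟨q, hq, hq1⟩ := exists_between hlt
  have hq0 : 0 < q := (norm_nonneg _).trans_lt hq
  have hl : 0 < -Real.log q / T := div_pos (neg_pos.2 (Real.log_neg hq0 hq1)) hT
  refine ⟨_, hl, Asymptotics.IsBigO.of_bound (q⁻¹ * M) ?_⟩
  filter_upwards [eventually_ge_atTop 0] with t ht
  have hfloor : (⌊t / T⌋₊ : ℝ) * T ≤ t := (le_div_iff₀ hT).1 (Nat.floor_le (by positivity))
  have hlt_floor : t < (⌊t / T⌋₊ + 1 : ℝ) * T := (div_lt_iff₀ hT).1 (Nat.lt_floor_add_one _)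
  have hrest : t - ⌊t / T⌋₊ * T ∈ Icc 0 T := ⟨by linarith, by linarith⟩
  have hM0 : 0 ≤ M := (norm_nonneg _).trans (hM _ hrest)
  calc ‖F t‖ = ‖F (⌊t / T⌋₊ * T + (t - ⌊t / T⌋₊ * T))‖ := by rw [add_sub_cancel]
    _ ≤ ‖F T‖ ^ ⌊t / T⌋₊ * ‖F (t - ⌊t / T⌋₊ * T)‖ := norm_map_nsmul_add_le hF hT.le _ hrest.1
    _ ≤ q ^ ⌊t / T⌋₊ * M := by gcongr; exact hM _ hrest
    _ ≤ q⁻¹ * Real.exp (-(-Real.log q / T) * t) * M := by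
        gcongr
        exact pow_floor_div_le_exp hq0 hq1
    _ = q⁻¹ * M * ‖Real.exp (-(-Real.log q / T) * t)‖ := by
        rw [Real.norm_eq_abs, Real.abs_exp]
        ring

section StateImpulse

variable {n : ℕ} {A : Matrix (Fin n) (Fin n) ℝ}

theorem stateImpulse_zero (A : Matrix (Fin n) (Fin n) ℝ) (b : Fin n → ℝ) :
    stateImpulse A b 0 = b := by
  simp [stateImpulse]

theorem hasDerivAt_stateImpulse (A : Matrix (Fin n) (Fin n) ℝ) (b : Fin n → ℝ) (t : ℝ) :
    HasDerivAt (stateImpulse A b) (A *ᵥ stateImpulse A b t) t :=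
  hasDerivAt_exp_smul_mulVec A b t

theorem continuous_stateImpulse (A : Matrix (Fin n) (Fin n) ℝ) (b : Fin n → ℝ) :
    Continuous (stateImpulse A b) :=
  continuous_iff_continuousAt.2 fun t => (hasDerivAt_stateImpulse A b t).continuousAt

theorem exp_add_smul (A : Matrix (Fin n) (Fin n) ℝ) (s t : ℝ) :
    NormedSpace.exp ((s + t) • A) = NormedSpace.exp (s • A) * NormedSpace.exp (t • A) := by
  rw [add_smul]
  exact Matrix.exp_add_of_commute _ _ (((Commute.refl A).smul_left s).smul_right t)

open scoped Matrix.Norms.Frobenius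

theorem IsHurwitz.exists_norm_exp_lt_one (hA : IsHurwitz A) :
    ∃ T > (0 : ℝ), ‖NormedSpace.exp (T • A)‖ < 1 := by
  rcases isEmpty_or_nonempty (Fin n) with hn | hn
  · exact ⟨1, one_pos, by rw [Subsingleton.elim (NormedSpace.exp _) 0, norm_zero]; exact one_pos⟩
  have hradius := spectralRadius_exp_lt_one hA
  obtain ⟨k, hk, hlt⟩ := exists_norm_pow_lt_one_of_spectralRadius_lt_one hradius
  refine ⟨k, by exact_mod_cast hk, ?_⟩
  have hmap : (NormedSpace.exp A).map (algebraMap ℝ ℂ) = NormedSpace.exp (A.map (algebraMap ℝ ℂ)) :=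
    NormedSpace.map_exp (algebraMap ℝ ℂ).mapMatrix
      (continuous_id.matrix_map Complex.continuous_ofReal) A
  rwa [Nat.cast_smul_eq_nsmul, Matrix.exp_nsmul,
    ← Matrix.frobenius_norm_map_eq _ (algebraMap ℝ ℂ) (by simp), Matrix.map_pow, hmap]

theorem IsHurwitz.exists_isBigO_stateImpulse (hA : IsHurwitz A) (b : Fin n → ℝ) :
    ∃ l > 0, stateImpulse A b =O[atTop] fun t => Real.exp (-l * t) := by
  obtain ⟨T, hT, hlt⟩ := hA.exists_norm_exp_lt_one
  have hcont : Continuous fun t : ℝ => NormedSpace.exp (t • A) :=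
    NormedSpace.exp_continuous.comp (by fun_prop)
  obtain ⟨l, hl, hO⟩ := exists_isBigO_exp_neg_of_map_add (fun s t _ _ => exp_add_smul A s t) hT
    hcont.continuousOn hlt
  exact ⟨l, hl, ((LinearMap.toContinuousLinearMap
    ((Matrix.mulVecBilin ℝ ℝ).flip b)).isBigO_comp _ _).trans hO⟩

theorem IsHurwitz.tendsto_stateImpulse (hA : IsHurwitz A) (b : Fin n → ℝ) :
    Tendsto (stateImpulse A b) atTop (𝓝 0) := by
  obtain ⟨l, hl, hO⟩ := hA.exists_isBigO_stateImpulse b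
  exact hO.trans_tendsto (Real.tendsto_exp_atBot.comp
    (tendsto_id.const_mul_atTop_of_neg (neg_neg_iff_pos.2 hl)))

theorem IsHurwitz.integrableOn_stateImpulse (hA : IsHurwitz A) (b : Fin n → ℝ) :
    IntegrableOn (stateImpulse A b) (Ioi 0) := by
  obtain ⟨l, hl, hO⟩ := hA.exists_isBigO_stateImpulse b
  have hcont := continuous_stateImpulse A b
  exact (integrable_norm_iff hcont.aestronglyMeasurable.restrict).1
    (integrable_of_isBigO_exp_neg hl hcont.norm.continuousOn hO.norm_left)

end StateImpulse

theorem exists_continuous_eqOn_Ici {X : Type*} [TopologicalSpace X] {v : ℝ → X} {a : ℝ}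
    (hv : ContinuousOn v (Ici a)) : ∃ w, Continuous w ∧ EqOn v w (Ici a) :=
  ⟨fun t => v (max t a), hv.comp_continuous (by fun_prop) fun _ => mem_Ici.2 (le_max_right _ _),
    fun t ht => congrArg v (max_eq_left (mem_Ici.1 ht)).symm⟩

theorem exists_norm_le_of_tendsto {E : Type*} [SeminormedAddCommGroup E] {v : ℝ → E}
    {l : E} {a : ℝ} (hv : ContinuousOn v (Ici a)) (hl : Tendsto v atTop (𝓝 l)) :
    ∃ B, ∀ t, a ≤ t → ‖v t‖ ≤ B := by
  obtain ⟨T, hT⟩ := eventually_atTop.1 (hl.norm.eventually_le_const (lt_add_one ‖l‖))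
  obtain ⟨B, hB⟩ := (isCompact_Icc (a := a) (b := T)).exists_bound_of_continuousOn
    (hv.mono Icc_subset_Ici_self)
  refine ⟨max B (‖l‖ + 1), fun t ht => ?_⟩
  rcases le_total t T with htT | htT
  · exact (hB t ⟨ht, htT⟩).trans (le_max_left _ _)
  · exact (hT t htT).trans (le_max_right _ _)

section Convolution

variable {E : Type*} [NormedAddCommGroup E] [NormedSpace ℝ E]

/-- The causal convolution `(f * v)(t) = ∫₀ᵗ f (t - τ) v(τ) dτ`, `t ≥ 0`, of a kernel `f` with a
signal `v`: the response, started at rest, of the system with impulse response `f`. The kernel may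
be vector valued (a system with several outputs). -/
def conv (f : ℝ → E) (v : ℝ → ℝ) (t : ℝ) : E := ∫ τ in (0 : ℝ)..t, v τ • f (t - τ)

theorem conv_congr {f g : ℝ → E} {v w : ℝ → ℝ} (hfg : EqOn f g (Ici 0)) (hvw : EqOn v w (Ici 0)) :
    EqOn (conv f v) (conv g w) (Ici 0) := fun t ht =>
  intervalIntegral.integral_congr fun τ hτ => by
    rw [uIcc_of_le ht] at hτ
    simp only [hvw (mem_Ici.2 hτ.1), hfg (mem_Ici.2 (sub_nonneg.2 hτ.2))]

theorem conv_eq_integral_sub (f : ℝ → E) (v : ℝ → ℝ) (t : ℝ) :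
    conv f v t = ∫ σ in (0 : ℝ)..t, v (t - σ) • f σ := by
  simpa [conv] using intervalIntegral.integral_comp_sub_left (a := 0) (b := t)
    (fun σ => v (t - σ) • f σ) t

theorem continuousOn_conv_integrand {f : ℝ → E} {v : ℝ → ℝ} (hf : ContinuousOn f (Ici 0))
    (hv : ContinuousOn v (Ici 0)) (t : ℝ) :
    ContinuousOn (fun τ => v τ • f (t - τ)) (Icc 0 t) :=
  (hv.mono Icc_subset_Ici_self).smul
    (hf.comp (by fun_prop) fun _ hτ => mem_Ici.2 (sub_nonneg.2 hτ.2))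

theorem intervalIntegrable_conv_integrand {f : ℝ → E} {v : ℝ → ℝ} (hf : ContinuousOn f (Ici 0))
    (hv : ContinuousOn v (Ici 0)) {t : ℝ} (ht : 0 ≤ t) :
    IntervalIntegrable (fun τ => v τ • f (t - τ)) volume 0 t :=
  (continuousOn_conv_integrand hf hv t).intervalIntegrable_of_Icc ht

theorem conv_add {f : ℝ → E} {v w : ℝ → ℝ} (hf : ContinuousOn f (Ici 0))
    (hv : ContinuousOn v (Ici 0)) (hw : ContinuousOn w (Ici 0)) {t : ℝ} (ht : 0 ≤ t) :
    conv f (v + w) t = conv f v t + conv f w t := by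
  simp only [conv, Pi.add_apply, add_smul]
  exact intervalIntegral.integral_add (intervalIntegrable_conv_integrand hf hv ht)
    (intervalIntegrable_conv_integrand hf hw ht)

theorem conv_sub {f : ℝ → E} {v w : ℝ → ℝ} (hf : ContinuousOn f (Ici 0))
    (hv : ContinuousOn v (Ici 0)) (hw : ContinuousOn w (Ici 0)) {t : ℝ} (ht : 0 ≤ t) :
    conv f (v - w) t = conv f v t - conv f w t := by
  simp only [conv, Pi.sub_apply, sub_smul]
  exact intervalIntegral.integral_sub (intervalIntegrable_conv_integrand hf hv ht)
    (intervalIntegrable_conv_integrand hf hw ht)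

theorem conv_sub_left {f g : ℝ → E} {v : ℝ → ℝ} (hf : ContinuousOn f (Ici 0))
    (hg : ContinuousOn g (Ici 0)) (hv : ContinuousOn v (Ici 0)) {t : ℝ} (ht : 0 ≤ t) :
    conv (f - g) v t = conv f v t - conv g v t := by
  simp only [conv, Pi.sub_apply, smul_sub]
  exact intervalIntegral.integral_sub (intervalIntegrable_conv_integrand hf hv ht)
    (intervalIntegrable_conv_integrand hg hv ht)

theorem map_conv {F : Type*} [NormedAddCommGroup F] [NormedSpace ℝ F] [CompleteSpace E]
    [CompleteSpace F] (L : E →L[ℝ] F) {f : ℝ → E} {v : ℝ → ℝ} (hf : ContinuousOn f (Ici 0))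
    (hv : ContinuousOn v (Ici 0)) {t : ℝ} (ht : 0 ≤ t) :
    L (conv f v t) = conv (fun τ => L (f τ)) v t := by
  simp only [conv, ← map_smul]
  exact (L.intervalIntegral_comp_comm (intervalIntegrable_conv_integrand hf hv ht)).symm

theorem continuousOn_conv {f : ℝ → E} {v : ℝ → ℝ} (hf : ContinuousOn f (Ici 0))
    (hv : ContinuousOn v (Ici 0)) : ContinuousOn (conv f v) (Ici 0) := by
  obtain ⟨g, hg, hfg⟩ := exists_continuous_eqOn_Ici hf
  obtain ⟨w, hw, hvw⟩ := exists_continuous_eqOn_Ici hv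
  refine ContinuousOn.congr (Continuous.continuousOn ?_) (conv_congr hfg hvw)
  exact intervalIntegral.continuous_parametric_intervalIntegral_of_continuous
    (f := fun t τ => w τ • g (t - τ)) (by fun_prop) continuous_id

theorem integral_integral_triangle {F : ℝ → ℝ → E} (hF : Continuous (Function.uncurry F)) {t : ℝ}
    (ht : 0 ≤ t) : ∫ τ in (0 : ℝ)..t, ∫ σ in (0 : ℝ)..τ, F τ σ =
      ∫ σ in (0 : ℝ)..t, ∫ τ in σ..t, F τ σ := by
  set G : ℝ → ℝ → E := fun τ σ => {p : ℝ × ℝ | p.2 ≤ p.1}.indicator (Function.uncurry F) (τ, σ)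
  have hG : IntegrableOn (Function.uncurry G) (uIoc 0 t ×ˢ uIoc 0 t) := by
    refine IntegrableOn.indicator ?_ (measurableSet_le measurable_snd measurable_fst)
    rw [uIoc_of_le ht]
    exact (hF.continuousOn.integrableOn_compact (isCompact_Icc.prod isCompact_Icc)).mono_set
      (prod_mono Ioc_subset_Icc_self Ioc_subset_Icc_self)
  calc ∫ τ in (0 : ℝ)..t, ∫ σ in (0 : ℝ)..τ, F τ σ
      = ∫ τ in (0 : ℝ)..t, ∫ σ in (0 : ℝ)..t, G τ σ := by
        refine intervalIntegral.integral_congr fun τ hτ => ?_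
        rw [uIcc_of_le ht] at hτ
        exact (intervalIntegral.integral_indicator (f := F τ) hτ).symm
    _ = ∫ σ in (0 : ℝ)..t, ∫ τ in (0 : ℝ)..t, G τ σ := intervalIntegral_intervalIntegral_swap hG
    _ = ∫ σ in (0 : ℝ)..t, ∫ τ in σ..t, F τ σ := by
        refine intervalIntegral.integral_congr_ae (Eventually.of_forall fun σ hσ => ?_)
        rw [uIoc_of_le ht] at hσ
        have hslice : (fun τ => G τ σ) = (Ici σ).indicator fun τ => F τ σ := by
          funext τ
          by_cases h : σ ≤ τ <;> simp [G, h]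
        have hinter : Ioc 0 t ∩ Ici σ = Icc σ t := by
          ext τ
          simp only [mem_inter_iff, mem_Ioc, mem_Ici, mem_Icc]
          exact ⟨fun h => ⟨h.2, h.1.2⟩, fun h => ⟨⟨hσ.1.trans_le h.1, h.2⟩, h.1⟩⟩
        rw [hslice, intervalIntegral.integral_of_le ht, intervalIntegral.integral_of_le hσ.2,
          setIntegral_indicator measurableSet_Ici, hinter, integral_Icc_eq_integral_Ioc]

theorem conv_conv [CompleteSpace E] {f : ℝ → E} {g v : ℝ → ℝ} (hf : ContinuousOn f (Ici 0))
    (hg : ContinuousOn g (Ici 0)) (hv : ContinuousOn v (Ici 0)) :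
    EqOn (conv f (conv g v)) (conv (conv f g) v) (Ici 0) := by
  obtain ⟨f', hf', hff'⟩ := exists_continuous_eqOn_Ici hf
  obtain ⟨g', hg', hgg'⟩ := exists_continuous_eqOn_Ici hg
  obtain ⟨v', hv', hvv'⟩ := exists_continuous_eqOn_Ici hv
  intro t ht
  rw [conv_congr hff' (conv_congr hgg' hvv') ht, conv_congr (conv_congr hff' hgg') hvv' ht]
  calc conv f' (conv g' v') t
      = ∫ τ in (0 : ℝ)..t, ∫ σ in (0 : ℝ)..τ, (v' σ * g' (τ - σ)) • f' (t - τ) := by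
        simp only [conv, intervalIntegral.integral_smul_const, smul_eq_mul]
    _ = ∫ σ in (0 : ℝ)..t, ∫ τ in σ..t, (v' σ * g' (τ - σ)) • f' (t - τ) :=
        integral_integral_triangle (by fun_prop) ht
    _ = conv (conv f' g') v' t := by
        refine intervalIntegral.integral_congr fun σ _ => ?_
        have hshift := intervalIntegral.integral_comp_sub_right (a := σ) (b := t)
          (fun ρ => g' ρ • f' (t - σ - ρ)) σ
        simp only [sub_self, sub_sub_sub_cancel_right] at hshift
        simp only [mul_smul, intervalIntegral.integral_smul, conv, ← hshift]

theorem conv_deriv {f f' v v' : ℝ → ℝ} (hf : ∀ t, HasDerivAt f (f' t) t) (hf' : Continuous f')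
    (hv : ∀ t, 0 ≤ t → HasDerivWithinAt v (v' t) (Ici 0) t) (hv' : ContinuousOn v' (Ici 0)) {t : ℝ}
    (ht : 0 ≤ t) : conv f v' t = f 0 * v t - f t * v 0 + conv f' v t := by
  have hsub : uIcc 0 t ⊆ Ici 0 := by
    rw [uIcc_of_le ht]
    exact Icc_subset_Ici_self
  have hparts := intervalIntegral.integral_mul_deriv_eq_deriv_mul_of_hasDerivWithinAt
    (a := 0) (b := t) (u := fun τ => f (t - τ)) (u' := fun τ => -f' (t - τ)) (v := v) (v' := v')
    (fun τ _ => by simpa using ((hf (t - τ)).comp_const_sub t τ).hasDerivWithinAt)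
    (fun τ hτ => (hv τ (hsub hτ)).mono hsub)
    (Continuous.intervalIntegrable (by fun_prop) _ _) (hv'.mono hsub).intervalIntegrable
  simp only [sub_self, sub_zero, neg_mul, intervalIntegral.integral_neg, sub_neg_eq_add] at hparts
  simp only [conv, smul_eq_mul, mul_comm (v' _), mul_comm (v _), hparts]

theorem integrableOn_conv {f : ℝ → E} {v : ℝ → ℝ} (hf : IntegrableOn f (Ioi 0))
    (hv : IntegrableOn v (Ioi 0)) : IntegrableOn (conv f v) (Ioi 0) :=
  (integrable_posConvolution hv hf (ContinuousLinearMap.lsmul ℝ ℝ)).integrableOn.congr_fun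
    (fun _ ht => indicator_of_mem ht _) measurableSet_Ioi

theorem norm_conv_le {f : ℝ → E} {v : ℝ → ℝ} (hf : IntegrableOn f (Ioi 0)) {B t : ℝ}
    (ht : 0 ≤ t) (hB : ∀ τ, 0 ≤ τ → τ ≤ t → |v τ| ≤ B) :
    ‖conv f v t‖ ≤ (∫ s in Ioi (0 : ℝ), ‖f s‖) * B := by
  have hB0 : 0 ≤ B := (abs_nonneg _).trans (hB 0 le_rfl ht)
  have hbound : IntegrableOn (fun σ => ‖f σ‖ * B) (Ioi 0) := hf.norm.mul_const B
  calc ‖conv f v t‖ ≤ ∫ σ in (0 : ℝ)..t, ‖f σ‖ * B := by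
        rw [conv_eq_integral_sub]
        refine intervalIntegral.norm_integral_le_of_norm_le ht
          (Eventually.of_forall fun σ hσ => ?_)
          ((intervalIntegrable_iff_integrableOn_Ioc_of_le ht).2
            (hbound.mono_set Ioc_subset_Ioi_self))
        rw [norm_smul, mul_comm]
        gcongr
        exact hB _ (by linarith [hσ.2]) (by linarith [hσ.1])
    _ ≤ ∫ σ in Ioi (0 : ℝ), ‖f σ‖ * B := by
        rw [intervalIntegral.integral_of_le ht]
        exact setIntegral_mono_set hbound (Eventually.of_forall fun _ => by positivity)
          (Eventually.of_forall fun _ => And.left)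
    _ = (∫ s in Ioi (0 : ℝ), ‖f s‖) * B := integral_mul_const _ _

theorem tendsto_conv_zero {f : ℝ → E} {v : ℝ → ℝ} (hf : IntegrableOn f (Ioi 0))
    (hv : ContinuousOn v (Ici 0)) (hv0 : Tendsto v atTop (𝓝 0)) :
    Tendsto (conv f v) atTop (𝓝 0) := by
  obtain ⟨B, hB⟩ := exists_norm_le_of_tendsto hv hv0
  obtain ⟨w, hw, hvw⟩ := exists_continuous_eqOn_Ici hv
  have hconv : (fun t => ∫ σ in Ioi (0 : ℝ), (Iic t).indicator (fun σ => w (t - σ) • f σ) σ)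
      =ᶠ[atTop] conv f v := by
    filter_upwards [eventually_ge_atTop 0] with t ht
    rw [conv_congr (fun _ _ => rfl) hvw ht, conv_eq_integral_sub,
      intervalIntegral.integral_of_le ht, setIntegral_indicator measurableSet_Iic,
      Ioi_inter_Iic]
  rw [← tendsto_congr' hconv, ← integral_zero ℝ E (μ := volume.restrict (Ioi 0))]
  refine tendsto_integral_filter_of_dominated_convergence (fun σ => B * ‖f σ‖)
    (Eventually.of_forall fun t => ?_) (Eventually.of_forall fun t => ?_) (hf.norm.const_mul B)
    (Eventually.of_forall fun σ => ?_)
  · exact ((by fun_prop : Continuous fun σ => w (t - σ)).aestronglyMeasurable.smul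
      hf.aestronglyMeasurable).indicator measurableSet_Iic
  · refine Eventually.of_forall fun σ => ?_
    by_cases hσ : σ ≤ t
    · rw [indicator_of_mem (mem_Iic.2 hσ), norm_smul, ← hvw (mem_Ici.2 (sub_nonneg.2 hσ))]
      gcongr
      exact hB _ (sub_nonneg.2 hσ)
    · rw [indicator_of_notMem (by simpa using hσ), norm_zero]
      exact mul_nonneg ((norm_nonneg _).trans (hB 0 le_rfl)) (norm_nonneg _)
  · have hlim : Tendsto (fun t => v (t - σ) • f σ) atTop (𝓝 0) := by
      simpa [sub_eq_add_neg] using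
        (hv0.comp (tendsto_atTop_add_const_right _ (-σ) tendsto_id)).smul_const (f σ)
    refine hlim.congr' ?_
    filter_upwards [eventually_ge_atTop σ] with t ht
    rw [indicator_of_mem (mem_Iic.2 ht), hvw (mem_Ici.2 (sub_nonneg.2 ht))]

-- The part of `v` exceeding `η` vanishes eventually, so its response fades out.
theorem eventually_norm_conv_le {f : ℝ → E} {v : ℝ → ℝ} (hf : IntegrableOn f (Ioi 0))
    (hfc : ContinuousOn f (Ici 0)) (hv : ContinuousOn v (Ici 0)) {η δ : ℝ}
    (hvη : ∀ᶠ t in atTop, |v t| ≤ η) (hδ : 0 < δ) :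
    ∀ᶠ t in atTop, ‖conv f v t‖ ≤ (∫ s in Ioi (0 : ℝ), ‖f s‖) * η + δ := by
  have hη : 0 ≤ η := hvη.exists.elim fun _ h => (abs_nonneg _).trans h
  let clipped : ℝ → ℝ := fun t => max (-η) (min η (v t))
  have hclipped : ContinuousOn clipped (Ici 0) := by fun_prop
  have hexcess : Tendsto (v - clipped) atTop (𝓝 0) := by
    refine tendsto_const_nhds.congr' ?_
    filter_upwards [hvη] with t ht
    rw [abs_le] at ht
    simp only [clipped, Pi.sub_apply, min_eq_right ht.2, max_eq_right ht.1, sub_self]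
  filter_upwards [(tendsto_conv_zero hf (hv.sub hclipped) hexcess).norm.eventually_le_const
    (norm_zero.trans_lt hδ), eventually_ge_atTop 0] with t hsmall ht
  calc ‖conv f v t‖ = ‖conv f clipped t + conv f (v - clipped) t‖ := by
        rw [← conv_add hfc hclipped (hv.sub hclipped) ht, add_sub_cancel]
    _ ≤ ‖conv f clipped t‖ + ‖conv f (v - clipped) t‖ := norm_add_le _ _
    _ ≤ (∫ s in Ioi (0 : ℝ), ‖f s‖) * η + δ := by
        refine add_le_add (norm_conv_le hf ht fun τ _ _ => ?_) hsmall
        exact abs_le.2 ⟨le_max_left _ _, max_le (by linarith) (min_le_left _ _)⟩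

end Convolution

section LinearODE

variable {m n : Type*} [Fintype n] {s : Set ℝ} {t : ℝ}

theorem hasDerivWithinAt_dotProduct {f g : ℝ → n → ℝ} {f' g' : n → ℝ}
    (hf : HasDerivWithinAt f f' s t) (hg : HasDerivWithinAt g g' s t) :
    HasDerivWithinAt (fun τ => f τ ⬝ᵥ g τ) (f t ⬝ᵥ g' + f' ⬝ᵥ g t) s t :=
  ContinuousLinearMap.hasDerivWithinAt_of_bilinear
    (B := LinearMap.toContinuousBilinearMap
      (dotProductBilin ℝ ℝ : (n → ℝ) →ₗ[ℝ] (n → ℝ) →ₗ[ℝ] ℝ)) hf hg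

theorem hasDerivAt_dotProduct {f g : ℝ → n → ℝ} {f' g' : n → ℝ}
    (hf : HasDerivAt f f' t) (hg : HasDerivAt g g' t) :
    HasDerivAt (fun τ => f τ ⬝ᵥ g τ) (f t ⬝ᵥ g' + f' ⬝ᵥ g t) t := by
  rw [← hasDerivWithinAt_univ] at *
  exact hasDerivWithinAt_dotProduct hf hg

theorem hasDerivWithinAt_const_mulVec [Finite m] (M : Matrix m n ℝ) {g : ℝ → n → ℝ} {g' : n → ℝ}
    (hg : HasDerivWithinAt g g' s t) : HasDerivWithinAt (fun τ => M *ᵥ g τ) (M *ᵥ g') s t :=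
  have := Fintype.ofFinite m
  (LinearMap.toContinuousLinearMap M.mulVecLin).hasFDerivAt.comp_hasDerivWithinAt t hg

theorem continuousOn_dotProduct {f g : ℝ → n → ℝ} (hf : ContinuousOn f s)
    (hg : ContinuousOn g s) : ContinuousOn (fun τ => f τ ⬝ᵥ g τ) s :=
  (by fun_prop : Continuous fun p : (n → ℝ) × (n → ℝ) => p.1 ⬝ᵥ p.2).comp_continuousOn
    (hf.prodMk hg)

open scoped Matrix.Norms.Frobenius in
theorem hasDerivWithinAt_exp_sub_smul_mulVec [DecidableEq n] (A : Matrix n n ℝ) (a : ℝ)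
    {g : ℝ → n → ℝ} {g' : n → ℝ} (hg : HasDerivWithinAt g g' s t) :
    HasDerivWithinAt (fun τ => NormedSpace.exp ((a - τ) • A) *ᵥ g τ)
      (NormedSpace.exp ((a - t) • A) *ᵥ (g' - A *ᵥ g t)) s t := by
  have hexp : HasDerivWithinAt (fun τ => NormedSpace.exp ((a - τ) • A))
      (-(NormedSpace.exp ((a - t) • A) * A)) s t :=
    ((hasDerivAt_exp_smul_const (𝕂 := ℝ) A (a - t)).comp_const_sub a t).hasDerivWithinAt
  refine (ContinuousLinearMap.hasDerivWithinAt_of_bilinear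
    (B := LinearMap.toContinuousBilinearMap
      (Matrix.mulVecBilin ℝ ℝ : Matrix n n ℝ →ₗ[ℝ] (n → ℝ) →ₗ[ℝ] n → ℝ)) hexp hg).congr_deriv ?_
  rw [Matrix.mulVec_sub, Matrix.mulVec_mulVec, sub_eq_add_neg (_ *ᵥ _), ← Matrix.neg_mulVec]
  rfl

end LinearODE

theorem eq_stateImpulse_add_conv {n : ℕ} {A : Matrix (Fin n) (Fin n) ℝ} {b : Fin n → ℝ}
    {y : ℝ → Fin n → ℝ} {f : ℝ → ℝ} (hf : ContinuousOn f (Ici 0))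
    (hy : ∀ t, 0 ≤ t → HasDerivWithinAt y (A *ᵥ y t + f t • b) (Ici 0) t) {t : ℝ} (ht : 0 ≤ t) :
    y t = stateImpulse A (y 0) t + conv (stateImpulse A b) f t := by
  let z : ℝ → Fin n → ℝ := fun τ => NormedSpace.exp ((t - τ) • A) *ᵥ y τ
  have hz : ∀ τ, 0 ≤ τ → HasDerivWithinAt z (f τ • stateImpulse A b (t - τ)) (Ici 0) τ :=
    fun τ hτ => by
      refine (hasDerivWithinAt_exp_sub_smul_mulVec A t (hy τ hτ)).congr_deriv ?_
      rw [add_sub_cancel_left, Matrix.mulVec_smul, stateImpulse]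
  have hint : IntervalIntegrable (fun τ => f τ • stateImpulse A b (t - τ)) volume 0 t :=
    intervalIntegrable_conv_integrand (continuous_stateImpulse A b).continuousOn hf ht
  have hftc : conv (stateImpulse A b) f t = z t - z 0 :=
    intervalIntegral.integral_eq_sub_of_hasDerivAt_of_le ht
      (fun τ hτ => (hz τ hτ.1).continuousWithinAt.mono Icc_subset_Ici_self)
      (fun τ hτ => (hz τ hτ.1.le).hasDerivAt (Ici_mem_nhds hτ.1)) hint
  have hzt : z t = y t := by simp only [z, sub_self, zero_smul, NormedSpace.exp_zero,
    Matrix.one_mulVec]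
  have hz0 : z 0 = stateImpulse A (y 0) t := by simp only [z, sub_zero, stateImpulse]
  rw [hftc, hzt, hz0, add_sub_cancel]

section AbsolutelyContinuous

variable {X Y : Type*} [PseudoMetricSpace X] [PseudoMetricSpace Y]

theorem absolutelyContinuousOnInterval_comp_of_lipschitzWith {g : X → Y} {K : NNReal}
    (hg : LipschitzWith K g) {f : ℝ → X} {a b : ℝ} (hf : AbsolutelyContinuousOnInterval f a b) :
    AbsolutelyContinuousOnInterval (fun t => g (f t)) a b := by
  refine squeeze_zero (fun t => Finset.sum_nonneg fun _ _ => dist_nonneg) (fun t => ?_)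
    (by simpa using Tendsto.const_mul (K : ℝ) hf)
  rw [Finset.mul_sum]
  exact Finset.sum_le_sum fun i _ => hg.dist_le_mul _ _

theorem absolutelyContinuousOnInterval_of_hasDerivWithinAt_Icc {E : Type*} [NormedAddCommGroup E]
    [NormedSpace ℝ E] {f f' : ℝ → E} {a b : ℝ} (hab : a ≤ b)
    (hf : ∀ t ∈ Icc a b, HasDerivWithinAt f (f' t) (Icc a b) t) (hf' : ContinuousOn f' (Icc a b)) :
    AbsolutelyContinuousOnInterval f a b := by
  obtain ⟨B, hB⟩ := isCompact_Icc.exists_bound_of_continuousOn hf'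
  have hlip : LipschitzOnWith B.toNNReal f (Icc a b) :=
    (convex_Icc a b).lipschitzOnWith_of_nnnorm_hasDerivWithin_le hf fun t ht =>
      NNReal.coe_le_coe.1 ((hB t ht).trans (Real.le_coe_toNNReal B))
  exact LipschitzOnWith.absolutelyContinuousOnInterval (by rwa [uIcc_of_le hab])

theorem absolutelyContinuousOnInterval_dotProduct {n : Type*} [Fintype n] {f g : ℝ → n → ℝ}
    {a b : ℝ} (hf : AbsolutelyContinuousOnInterval f a b)
    (hg : AbsolutelyContinuousOnInterval g a b) :
    AbsolutelyContinuousOnInterval (fun t => f t ⬝ᵥ g t) a b := by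
  have hcoord : ∀ {v : ℝ → n → ℝ}, AbsolutelyContinuousOnInterval v a b →
      ∀ i, AbsolutelyContinuousOnInterval (fun t => v t i) a b := fun hv i =>
    absolutelyContinuousOnInterval_comp_of_lipschitzWith (g := Function.eval i)
      (LipschitzWith.eval i) hv
  have hterm : ∀ i, AbsolutelyContinuousOnInterval (fun t => f t i * g t i) a b := fun i =>
    (hcoord hf i).mul (hcoord hg i)
  simp only [dotProduct]
  induction Finset.univ (α := n) using Finset.cons_induction with
  | empty =>
    simpa only [Finset.sum_empty] using
      (LipschitzWith.const (0 : ℝ)).lipschitzOnWith.absolutelyContinuousOnInterval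
  | cons i s _ ih =>
    simp only [Finset.sum_cons]
    exact (hterm i).add ih

theorem sub_le_integral_of_absolutelyContinuousOnInterval {f g : ℝ → ℝ} {s t : ℝ} (hst : s ≤ t)
    (hf : AbsolutelyContinuousOnInterval f s t) (hg : IntervalIntegrable g volume s t)
    (hfg : ∀ᵐ τ, τ ∈ Ioc s t → ∀ d, HasDerivAt f d τ → d ≤ g τ) :
    f t - f s ≤ ∫ τ in s..t, g τ := by
  rw [← hf.integral_deriv_eq_sub]
  refine intervalIntegral.integral_mono_ae_restrict hst hf.intervalIntegrable_deriv hg ?_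
  rw [← restrict_Ioc_eq_restrict_Icc]
  refine (ae_restrict_iff' measurableSet_Ioc).2 ?_
  filter_upwards [hfg, hf.ae_differentiableAt] with τ hle hdiff hτ
  refine hle hτ _ (hdiff ?_).hasDerivAt
  rw [uIcc_of_le hst]
  exact Ioc_subset_Icc_self hτ

theorem continuousOn_Ici_of_absolutelyContinuousOnInterval {E : Type*} [SeminormedAddCommGroup E]
    {f : ℝ → E} {a : ℝ} (hf : ∀ T, a ≤ T → AbsolutelyContinuousOnInterval f a T) :
    ContinuousOn f (Ici a) := by
  intro t ht
  have hle : a ≤ t + 1 := by linarith [mem_Ici.1 ht]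
  have hcont : ContinuousOn f (Icc a (t + 1)) := uIcc_of_le hle ▸ (hf _ hle).continuousOn
  refine (hcont t ⟨ht, by linarith⟩).mono_of_mem_nhdsWithin ?_
  rw [← Ici_inter_Iic]
  exact inter_mem self_mem_nhdsWithin (mem_nhdsWithin_of_mem_nhds (Iic_mem_nhds (lt_add_one t)))

end AbsolutelyContinuous

section Viability

/-- The closed cone of directions from a point `x` of a topological vector space into the set `K`:
`dirCone` freed from coordinates, so that it can be used in inner product spaces. -/
def feasibleCone {E : Type*} [TopologicalSpace E] [AddCommGroup E] [Module ℝ E] (K : Set E)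
    (x : E) : Set E :=
  closure {v | ∃ z ∈ K, ∃ a : ℝ, 0 ≤ a ∧ v = a • (z - x)}

variable {E : Type*} [NormedAddCommGroup E] [InnerProductSpace ℝ E] {K : Set E} {x p : E}

theorem inner_sub_nonpos_of_mem_feasibleCone (hK : Convex ℝ K) (hp : p ∈ K)
    (hdist : Metric.infDist x K = dist x p) {v : E} (hv : v ∈ feasibleCone K x) :
    inner ℝ (x - p) v ≤ 0 := by
  have hnearest : ∀ z ∈ K, inner ℝ (x - p) (z - p) ≤ 0 := by
    refine (norm_eq_iInf_iff_real_inner_le_zero hK hp).1 ?_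
    simp only [← dist_eq_norm, ← hdist, Metric.infDist_eq_iInf]
  refine closure_minimal ?_ (isClosed_le (by fun_prop) continuous_const :
    IsClosed {v | inner ℝ (x - p) v ≤ 0}) hv
  rintro _ ⟨z, hz, a, ha, rfl⟩
  rw [mem_ofPred_eq, inner_smul_right, ← sub_sub_sub_cancel_right z x p, inner_sub_right]
  exact mul_nonpos_of_nonneg_of_nonpos ha
    (sub_nonpos.2 ((hnearest z hz).trans real_inner_self_nonneg))

-- `dist (u τ) p ^ 2 - infDist (u τ) K ^ 2` is nonnegative and vanishes at `t`.
theorem eq_two_mul_inner_of_hasDerivAt_infDist_sq (hp : p ∈ K) {u : ℝ → E} {t D : ℝ} {v : E}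
    (hdist : Metric.infDist (u t) K = dist (u t) p) (hu : HasDerivAt u v t)
    (hD : HasDerivAt (fun τ => Metric.infDist (u τ) K ^ 2) D t) :
    D = 2 * inner ℝ (u t - p) v := by
  have hmin : IsLocalMin (fun τ => ‖u τ - p‖ ^ 2 - Metric.infDist (u τ) K ^ 2) t :=
    Eventually.of_forall fun τ => by
      simp only [hdist, dist_eq_norm, sub_self, sub_nonneg]
      rw [← dist_eq_norm]
      exact pow_le_pow_left₀ Metric.infDist_nonneg (Metric.infDist_le_dist_of_mem hp) 2
  have hderiv := (hu.sub_const p).norm_sq.sub hD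
  exact (sub_eq_zero.1 (hmin.hasDerivAt_eq_zero hderiv)).symm

theorem mem_of_ae_hasDerivAt_mem_feasibleCone (hK : Convex ℝ K) (hKc : IsComplete K) {u : ℝ → E}
    {a t : ℝ} (hat : a ≤ t) (hu : AbsolutelyContinuousOnInterval u a t) (ha : u a ∈ K)
    (hd : ∀ᵐ τ, τ ∈ Ioc a t → ∃ v ∈ feasibleCone K (u τ), HasDerivAt u v τ) : u t ∈ K := by
  have hne : K.Nonempty := ⟨_, ha⟩
  have hac : AbsolutelyContinuousOnInterval (fun τ => Metric.infDist (u τ) K ^ 2) a t := by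
    have hdist := absolutelyContinuousOnInterval_comp_of_lipschitzWith
      (Metric.lipschitz_infDist_pt K) hu
    simp only [sq]
    exact hdist.mul hdist
  have hle : Metric.infDist (u t) K ^ 2 - Metric.infDist (u a) K ^ 2 ≤ ∫ _ in a..t, (0 : ℝ) := by
    refine sub_le_integral_of_absolutelyContinuousOnInterval hat hac (by simp) ?_
    filter_upwards [hd] with τ hdτ hτ D hD
    obtain ⟨v, hv, huv⟩ := hdτ hτ
    obtain ⟨p, hp, hnearest⟩ := exists_norm_eq_iInf_of_complete_convex hne hKc hK (u τ)
    have hdist : Metric.infDist (u τ) K = dist (u τ) p := by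
      simp only [Metric.infDist_eq_iInf, dist_eq_norm, hnearest]
    rw [eq_two_mul_inner_of_hasDerivAt_infDist_sq hp hdist huv hD]
    linarith [inner_sub_nonpos_of_mem_feasibleCone hK hp hdist hv]
  rw [Metric.infDist_zero_of_mem ha, intervalIntegral.integral_zero] at hle
  refine (hKc.isClosed.mem_iff_infDist_zero hne).2 (pow_eq_zero_iff two_ne_zero |>.1 ?_)
  exact le_antisymm (by simpa using hle) (sq_nonneg _)

end Viability

section ParameterProjection

variable {n : ℕ} {Ω : Set (Fin n → ℝ)}

theorem mem_of_ae_hasDerivAt_mem_dirCone (hΩ : Convex ℝ Ω) (hΩc : IsClosed Ω)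
    {ϑ : ℝ → Fin n → ℝ} {a t : ℝ} (hat : a ≤ t) (hϑ : AbsolutelyContinuousOnInterval ϑ a t)
    (ha : ϑ a ∈ Ω) (hd : ∀ᵐ τ, τ ∈ Ioc a t → ∃ v ∈ dirCone Ω (ϑ τ), HasDerivAt ϑ v τ) :
    ϑ t ∈ Ω := by
  let L : (Fin n → ℝ) ≃L[ℝ] EuclideanSpace ℝ (Fin n) := (EuclideanSpace.equiv (Fin n) ℝ).symm
  have hcone : ∀ θ, MapsTo L (dirCone Ω θ) (feasibleCone (L '' Ω) (L θ)) := fun θ => by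
    refine MapsTo.closure ?_ L.continuous
    rintro _ ⟨z, hz, a, ha, rfl⟩
    exact ⟨L z, mem_image_of_mem L hz, a, ha, by rw [map_smul, map_sub]⟩
  refine (L.injective.mem_set_image (s := Ω)).1
    (mem_of_ae_hasDerivAt_mem_feasibleCone (u := fun τ => L (ϑ τ)) (hΩ.linear_image L.toLinearMap)
      (L.toHomeomorph.isClosedMap Ω hΩc).isComplete hat ?_ (mem_image_of_mem L ha) ?_)
  · exact absolutelyContinuousOnInterval_comp_of_lipschitzWith L.toContinuousLinearMap.lipschitz hϑ
  · filter_upwards [hd] with τ hdτ hτ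
    obtain ⟨v, hv, hϑv⟩ := hdτ hτ
    exact ⟨L v, hcone _ hv, L.hasFDerivAt.comp_hasDerivAt τ hϑv⟩

open scoped Pointwise in
theorem add_mem_dirCone (hΩ : Convex ℝ Ω) {θ v w : Fin n → ℝ} (hv : v ∈ dirCone Ω θ)
    (hw : w ∈ dirCone Ω θ) : v + w ∈ dirCone Ω θ := by
  refine map_mem_closure₂ continuous_add hv hw ?_
  rintro _ ⟨z, hz, a, ha, rfl⟩ _ ⟨z', hz', a', ha', rfl⟩
  obtain ⟨y, hy, hsum : (a + a') • y = a • z + a' • z'⟩ : a • z + a' • z' ∈ (a + a') • Ω := by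
    rw [hΩ.add_smul ha ha']
    exact add_mem_add (smul_mem_smul_set hz) (smul_mem_smul_set hz')
  refine ⟨y, hy, a + a', add_nonneg ha ha', ?_⟩
  rw [smul_sub, smul_sub, smul_sub, hsum, add_smul, add_sub_add_comm]

theorem sub_proj_dotProduct_nonpos (hΩ : Convex ℝ Ω) (θ y : Fin n → ℝ) {z : Fin n → ℝ}
    (hz : z ∈ Ω) : (y - Proj Ω θ y) ⬝ᵥ (z - θ) ≤ 0 := by
  obtain ⟨hp, hmin⟩ := isNearest_proj hΩ ⟨z, hz⟩ θ y
  set p := Proj Ω θ y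
  set v := z - θ
  have hquad : ∀ s : ℝ, 0 < s → 2 * ((y - p) ⬝ᵥ v) ≤ s * (v ⬝ᵥ v) := fun s hs => by
    have hle := hmin (p + s • v)
      (add_mem_dirCone hΩ hp (subset_closure ⟨z, hz, s, hs.le, rfl⟩))
    have hexpand : (y - (p + s • v)) ⬝ᵥ (y - (p + s • v)) =
        (y - p) ⬝ᵥ (y - p) - s * (2 * ((y - p) ⬝ᵥ v)) + s * (s * (v ⬝ᵥ v)) := by
      rw [← sub_sub]
      generalize y - p = q
      simp only [sub_dotProduct, dotProduct_sub, smul_dotProduct, dotProduct_smul, smul_eq_mul,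
        dotProduct_comm v q]
      ring
    exact le_of_mul_le_mul_left (by linarith) hs
  have hlim : Tendsto (fun s : ℝ => s * (v ⬝ᵥ v)) (𝓝[>] 0) (𝓝 0) :=
    tendsto_nhdsWithin_of_tendsto_nhds
      ((continuous_mul_const (v ⬝ᵥ v)).tendsto' 0 0 (zero_mul _))
  linarith [ge_of_tendsto hlim (eventually_nhdsWithin_of_forall hquad)]

end ParameterProjection

section Lyapunov

variable {ι : Type*} [Fintype ι]

theorem hasDerivWithinAt_dotProduct_mulVec (M : Matrix ι ι ℝ) {v w : ℝ → ι → ℝ} {v' w' : ι → ℝ}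
    {s : Set ℝ} {t : ℝ} (hv : HasDerivWithinAt v v' s t) (hw : HasDerivWithinAt w w' s t) :
    HasDerivWithinAt (fun τ => v τ ⬝ᵥ (M *ᵥ w τ)) (v t ⬝ᵥ (M *ᵥ w') + v' ⬝ᵥ (M *ᵥ w t)) s t :=
  hasDerivWithinAt_dotProduct hv (hasDerivWithinAt_const_mulVec M hw)

theorem dotProduct_mulVec_transpose_mul_add_mul (A M : Matrix ι ι ℝ) (v w : ι → ℝ) :
    v ⬝ᵥ ((Aᵀ * M + M * A) *ᵥ w) = v ⬝ᵥ (M *ᵥ (A *ᵥ w)) + (A *ᵥ v) ⬝ᵥ (M *ᵥ w) := by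
  rw [Matrix.add_mulVec, dotProduct_add, ← Matrix.mulVec_mulVec, ← Matrix.mulVec_mulVec,
    Matrix.dotProduct_mulVec v Aᵀ, Matrix.vecMul_transpose, add_comm]

variable {n : ℕ} {A M P Q : Matrix (Fin n) (Fin n) ℝ}

theorem hasDerivAt_stateImpulse_dotProduct_mulVec (A M : Matrix (Fin n) (Fin n) ℝ)
    (v w : Fin n → ℝ) (t : ℝ) :
    HasDerivAt (fun t => stateImpulse A v t ⬝ᵥ (M *ᵥ stateImpulse A w t))
      (stateImpulse A v t ⬝ᵥ ((Aᵀ * M + M * A) *ᵥ stateImpulse A w t)) t := by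
  rw [dotProduct_mulVec_transpose_mul_add_mul]
  exact (hasDerivWithinAt_dotProduct_mulVec M (hasDerivAt_stateImpulse A v t).hasDerivWithinAt
    (hasDerivAt_stateImpulse A w t).hasDerivWithinAt).hasDerivAt univ_mem

theorem IsHurwitz.tendsto_stateImpulse_dotProduct_mulVec (hA : IsHurwitz A)
    (M : Matrix (Fin n) (Fin n) ℝ) (v w : Fin n → ℝ) :
    Tendsto (fun t => stateImpulse A v t ⬝ᵥ (M *ᵥ stateImpulse A w t)) atTop (𝓝 0) := by
  have hcont : Continuous fun p : (Fin n → ℝ) × (Fin n → ℝ) => p.1 ⬝ᵥ (M *ᵥ p.2) := by fun_prop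
  simpa [Function.comp_def] using (hcont.tendsto (0, 0)).comp
    ((hA.tendsto_stateImpulse v).prodMk_nhds (hA.tendsto_stateImpulse w))

theorem IsHurwitz.eq_zero_of_lyapunov (hA : IsHurwitz A) (hM : Aᵀ * M + M * A = 0) : M = 0 := by
  have hform : ∀ v w, v ⬝ᵥ (M *ᵥ w) = 0 := fun v w => by
    have hderiv := fun t => hasDerivAt_stateImpulse_dotProduct_mulVec A M v w t
    simp only [hM, Matrix.zero_mulVec, dotProduct_zero] at hderiv
    have hconst := is_const_of_deriv_eq_zero (fun t => (hderiv t).differentiableAt)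
      fun t => (hderiv t).deriv
    have hlim := tendsto_nhds_unique (tendsto_const_nhds.congr fun t => hconst 0 t)
      (hA.tendsto_stateImpulse_dotProduct_mulVec M v w)
    simpa only [stateImpulse_zero] using hlim
  ext i j
  simpa using hform (Pi.single i 1) (Pi.single j 1)

theorem IsHurwitz.isSymm_of_lyapunov (hA : IsHurwitz A) (hQ : Q.IsSymm)
    (hP : Aᵀ * P + P * A = -Q) : P.IsSymm := by
  have hPt : Aᵀ * Pᵀ + Pᵀ * A = -Q := by
    simpa [Matrix.transpose_mul, add_comm, hQ.eq] using congrArg Matrix.transpose hP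
  refine sub_eq_zero.1 (hA.eq_zero_of_lyapunov ?_)
  rw [mul_sub, sub_mul, sub_add_sub_comm, hPt, hP, sub_self]

theorem IsHurwitz.posDef_of_lyapunov (hA : IsHurwitz A) (hQ : Q.PosDef)
    (hP : Aᵀ * P + P * A = -Q) : P.PosDef := by
  have hPs : P.IsSymm := hA.isSymm_of_lyapunov (Matrix.isHermitian_iff_isSymm.1 hQ.isHermitian) hP
  refine .of_dotProduct_mulVec_pos (Matrix.isHermitian_iff_isSymm.2 hPs) fun v hv => ?_
  let V : ℝ → ℝ := fun t => stateImpulse A v t ⬝ᵥ (P *ᵥ stateImpulse A v t)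
  have hV : ∀ t, HasDerivAt V (-(stateImpulse A v t ⬝ᵥ (Q *ᵥ stateImpulse A v t))) t := fun t => by
    simpa only [hP, Matrix.neg_mulVec, dotProduct_neg] using
      hasDerivAt_stateImpulse_dotProduct_mulVec A P v v t
  have hanti : Antitone V := antitone_of_hasDerivAt_nonpos hV fun t =>
    neg_nonpos.2 (hQ.posSemidef.dotProduct_mulVec_nonneg _)
  have hnonneg : ∀ t, 0 ≤ V t :=
    hanti.le_of_tendsto (hA.tendsto_stateImpulse_dotProduct_mulVec P v v)
  have hV0 : V 0 = v ⬝ᵥ (P *ᵥ v) := by simp only [V, stateImpulse_zero]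
  rw [star_trivial, ← hV0]
  refine (hnonneg 0).lt_of_ne fun hzero => ?_
  have hmin : IsLocalMin V 0 := Eventually.of_forall fun t => hzero ▸ hnonneg t
  have hQv := hmin.hasDerivAt_eq_zero (hV 0)
  rw [stateImpulse_zero, neg_eq_zero] at hQv
  exact (hQ.dotProduct_mulVec_pos hv).ne' hQv

theorem exists_pos_mul_norm_sq_le_of_posDef {M : Matrix ι ι ℝ} (hM : M.PosDef) :
    ∃ c : ℝ, 0 < c ∧ ∀ v, c * ‖v‖ ^ 2 ≤ v ⬝ᵥ (M *ᵥ v) := by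
  obtain ⟨c, hc, hsphere⟩ : ∃ c : ℝ, 0 < c ∧ ∀ v : ι → ℝ, ‖v‖ = 1 → c ≤ v ⬝ᵥ (M *ᵥ v) := by
    rcases (Metric.sphere (0 : ι → ℝ) 1).eq_empty_or_nonempty with hempty | hne
    · exact ⟨1, one_pos, fun v hv =>
        (Set.eq_empty_iff_forall_notMem.1 hempty v (mem_sphere_zero_iff_norm.2 hv)).elim⟩
    · obtain ⟨v, hv, hmin⟩ := (isCompact_sphere (0 : ι → ℝ) 1).exists_isMinOn hne
        (f := fun v => v ⬝ᵥ (M *ᵥ v)) (by fun_prop)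
      refine ⟨v ⬝ᵥ (M *ᵥ v), hM.dotProduct_mulVec_pos ?_, fun w hw =>
        hmin (mem_sphere_zero_iff_norm.2 hw)⟩
      exact ne_zero_of_mem_unit_sphere ⟨v, hv⟩
  refine ⟨c, hc, fun v => ?_⟩
  rcases eq_or_ne v 0 with rfl | hv
  · simp
  have hnorm : 0 < ‖v‖ := norm_pos_iff.2 hv
  have hunit := hsphere (‖v‖⁻¹ • v)
    (by rw [norm_smul, norm_inv, norm_norm, inv_mul_cancel₀ hnorm.ne'])
  rw [Matrix.mulVec_smul, smul_dotProduct, dotProduct_smul, smul_eq_mul, smul_eq_mul] at hunit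
  calc c * ‖v‖ ^ 2 ≤ ‖v‖⁻¹ * (‖v‖⁻¹ * (v ⬝ᵥ (M *ᵥ v))) * ‖v‖ ^ 2 := by gcongr
    _ = v ⬝ᵥ (M *ᵥ v) := by field_simp

/-- The Lyapunov function `eᵀ P e + |φ|² / Γ` of the adaptation, in the prediction error `e` and
the parameter error `φ`. -/
def lyapunovFn (P : Matrix (Fin n) (Fin n) ℝ) (Γ : ℝ) (e φ : Fin n → ℝ) : ℝ :=
  e ⬝ᵥ (P *ᵥ e) + Γ⁻¹ * (φ ⬝ᵥ φ)

theorem le_lyapunovFn {Γ : ℝ} (hΓ : 0 ≤ Γ) (e φ : Fin n → ℝ) :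
    e ⬝ᵥ (P *ᵥ e) ≤ lyapunovFn P Γ e φ :=
  le_add_of_nonneg_right (mul_nonneg (inv_nonneg.2 hΓ) (dotProduct_self_star_nonneg φ))

theorem hasDerivAt_lyapunovFn (hP : P.IsSymm) (Γ : ℝ) {e φ : ℝ → Fin n → ℝ} {e' φ' : Fin n → ℝ}
    {t : ℝ} (he : HasDerivAt e e' t) (hφ : HasDerivAt φ φ' t) :
    HasDerivAt (fun τ => lyapunovFn P Γ (e τ) (φ τ))
      (2 * (e t ⬝ᵥ (P *ᵥ e')) + Γ⁻¹ * (2 * (φ' ⬝ᵥ φ t))) t := by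
  have hquad := (hasDerivWithinAt_dotProduct_mulVec P he.hasDerivWithinAt
    he.hasDerivWithinAt).hasDerivAt univ_mem
  refine (hquad.add ((hasDerivAt_dotProduct hφ hφ).const_mul Γ⁻¹)).congr_deriv ?_
  have hcomm : e' ⬝ᵥ (P *ᵥ e t) = e t ⬝ᵥ (P *ᵥ e') := by
    rw [Matrix.dotProduct_mulVec, ← Matrix.mulVec_transpose, hP.eq, dotProduct_comm]
  rw [hcomm, dotProduct_comm (φ t), ← two_mul, ← two_mul]

-- The projection only helps: the part it removes is an outward normal at `ϑ`, and `θ` is in `Ω`.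
theorem lyapunov_rate_le {b e x ϑ θ : Fin n → ℝ} {Ω : Set (Fin n → ℝ)} {Γ : ℝ} (hPs : P.IsSymm)
    (hP : Aᵀ * P + P * A = -Q) (hΩ : Convex ℝ Ω) (hθ : θ ∈ Ω) (hΓ : 0 < Γ) :
    2 * (e ⬝ᵥ (P *ᵥ (A *ᵥ e - ((ϑ - θ) ⬝ᵥ x) • b))) +
      Γ⁻¹ * (2 * ((Γ • Proj Ω ϑ ((e ⬝ᵥ (P *ᵥ b)) • x)) ⬝ᵥ (ϑ - θ))) ≤ -(e ⬝ᵥ (Q *ᵥ e)) := by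
  have hcomm : (A *ᵥ e) ⬝ᵥ (P *ᵥ e) = e ⬝ᵥ (P *ᵥ (A *ᵥ e)) := by
    rw [Matrix.dotProduct_mulVec, ← Matrix.mulVec_transpose, hPs.eq, dotProduct_comm]
  have hrate : 2 * (e ⬝ᵥ (P *ᵥ (A *ᵥ e))) = -(e ⬝ᵥ (Q *ᵥ e)) := by
    have hform := dotProduct_mulVec_transpose_mul_add_mul A P e e
    rw [hP, Matrix.neg_mulVec, dotProduct_neg, hcomm] at hform
    linarith
  have hproj := sub_proj_dotProduct_nonpos hΩ ϑ ((e ⬝ᵥ (P *ᵥ b)) • x) hθ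
  rw [← neg_sub ϑ θ, dotProduct_neg, sub_dotProduct, smul_dotProduct, smul_eq_mul,
    dotProduct_comm x] at hproj
  rw [smul_dotProduct, smul_eq_mul, mul_left_comm 2, inv_mul_cancel_left₀ hΓ.ne',
    Matrix.mulVec_sub, Matrix.mulVec_smul, dotProduct_sub, dotProduct_smul, smul_eq_mul]
  linarith

end Lyapunov

-- `f ^ 2` and its derivative `2 f f'` are both integrable, which forces `f ^ 2` to vanish at
-- infinity.
theorem tendsto_zero_of_integrableOn_of_bounded_deriv {f f' : ℝ → ℝ} {a B B' : ℝ}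
    (hf : ∀ t, a < t → HasDerivAt f (f' t) t) (hfB : ∀ t, a < t → |f t| ≤ B)
    (hfB' : ∀ t, a < t → |f' t| ≤ B') (hfi : IntegrableOn f (Ioi a)) :
    Tendsto f atTop (𝓝 0) := by
  have hderiv : ∀ t ∈ Ioi a, HasDerivAt (fun t => f t ^ 2) (2 * f' t * f t) t := fun t ht =>
    ((hf t ht).pow 2).congr_deriv (by simp only [Nat.cast_ofNat]; ring)
  have hf'm : AEStronglyMeasurable (fun t => 2 * f' t) (volume.restrict (Ioi a)) :=
    ((stronglyMeasurable_deriv f).aestronglyMeasurable.congr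
      ((ae_restrict_iff' measurableSet_Ioi).2
        (Eventually.of_forall fun t ht => (hf t ht).deriv))).const_mul 2
  have hint : IntegrableOn (fun t => 2 * f' t * f t) (Ioi a) := by
    refine Integrable.bdd_mul hfi hf'm (c := 2 * B') ?_
    refine (ae_restrict_iff' measurableSet_Ioi).2 (Eventually.of_forall fun t ht => ?_)
    rw [norm_mul, Real.norm_ofNat, Real.norm_eq_abs]
    exact mul_le_mul_of_nonneg_left (hfB' t ht) zero_le_two
  have hsq : IntegrableOn (fun t => f t ^ 2) (Ioi a) := by
    simp only [sq]
    exact Integrable.bdd_mul hfi hfi.aestronglyMeasurable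
      ((ae_restrict_iff' measurableSet_Ioi).2 (Eventually.of_forall hfB))
  have hlim := tendsto_zero_of_hasDerivAt_of_integrableOn_Ioi hderiv hint hsq
  simpa [Real.sqrt_sq_eq_abs, tendsto_zero_iff_abs_tendsto_zero f, Function.comp_def] using
    hlim.sqrt

theorem integrableOn_Ioi_of_sub_le_neg_integral {f V : ℝ → ℝ} {a : ℝ}
    (hf : ContinuousOn f (Ici a)) (hf0 : ∀ t, a ≤ t → 0 ≤ f t) (hV0 : ∀ t, a ≤ t → 0 ≤ V t)
    (hV : ∀ t, a ≤ t → V t - V a ≤ -∫ τ in a..t, f τ) : IntegrableOn f (Ioi a) := by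
  refine integrableOn_Ioi_of_intervalIntegral_norm_bounded (V a) a (b := id) (l := atTop)
    (fun t => ?_) tendsto_id ?_
  · exact ((hf.mono Icc_subset_Ici_self).integrableOn_Icc).mono_set Ioc_subset_Icc_self
  · filter_upwards [eventually_ge_atTop a] with t ht
    have hnorm : ∫ τ in a..t, ‖f τ‖ = ∫ τ in a..t, f τ :=
      intervalIntegral.integral_congr fun τ hτ => by
        rw [uIcc_of_le ht] at hτ
        exact Real.norm_of_nonneg (hf0 τ hτ.1)
    rw [id, hnorm]
    linarith [hV t ht, hV0 t ht]

section SmallGain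

variable {E : Type*} [NormedAddCommGroup E]

theorem norm_le_of_small_gain {y : ℝ → E} (hy : ContinuousOn y (Ici 0)) {D ρ : ℝ} (hρ : ρ < 1)
    (h : ∀ t, 0 ≤ t → ∀ B, (∀ τ, 0 ≤ τ → τ ≤ t → ‖y τ‖ ≤ B) → ‖y t‖ ≤ D + ρ * B) {t : ℝ}
    (ht : 0 ≤ t) : ‖y t‖ ≤ D / (1 - ρ) := by
  obtain ⟨s, hs, hmax⟩ := isCompact_Icc.exists_isMaxOn ⟨0, le_rfl, ht⟩
    (hy.norm.mono (Icc_subset_Ici_self (a := t) (b := 0)))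
  have hys : ‖y s‖ ≤ D + ρ * ‖y s‖ :=
    h s hs.1 ‖y s‖ fun τ hτ0 hτs => hmax (a := τ) ⟨hτ0, hτs.trans hs.2⟩
  calc ‖y t‖ ≤ ‖y s‖ := hmax (a := t) ⟨ht, le_rfl⟩
    _ ≤ D / (1 - ρ) := (le_div_iff₀ (by linarith)).2 (by linarith)

theorem tendsto_zero_of_small_gain {y : ℝ → E} {B ρ : ℝ} (hB : ∀ᶠ t in atTop, ‖y t‖ ≤ B)
    (hρ : ρ < 1) (h : ∀ η, (∀ᶠ t in atTop, ‖y t‖ ≤ η) → ∀ δ, 0 < δ →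
      ∀ᶠ t in atTop, ‖y t‖ ≤ ρ * η + δ) : Tendsto y atTop (𝓝 0) := by
  have hbdd : IsBoundedUnder (· ≤ ·) atTop fun t => ‖y t‖ := ⟨B, hB⟩
  have hcobdd : IsCoboundedUnder (· ≤ ·) atTop fun t => ‖y t‖ :=
    (isBoundedUnder_of ⟨0, fun t => norm_nonneg (y t)⟩).isCoboundedUnder_le
  set L := limsup (fun t => ‖y t‖) atTop
  have hL : L ≤ ρ * L := by
    have hstep : ∀ η, L < η → L ≤ ρ * η := fun η hη =>
      le_of_forall_pos_le_add fun δ hδ => limsup_le_of_le hcobdd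
        (h η ((eventually_lt_of_limsup_lt hη hbdd).mono fun _ => le_of_lt) δ hδ)
    exact ge_of_tendsto (((tendsto_id (x := 𝓝[>] L)).mono_right nhdsWithin_le_nhds).const_mul ρ)
      (eventually_mem_nhdsWithin.mono hstep)
  have hL0 : L ≤ 0 := by nlinarith
  refine squeeze_zero_norm' (Eventually.of_forall fun t => le_rfl) ?_
  refine tendsto_order.2 ⟨fun a ha => Eventually.of_forall fun t => ha.trans_le (norm_nonneg _),
    fun a ha => eventually_lt_of_limsup_lt (hL0.trans_lt ha) hbdd⟩

end SmallGain

section L1Gain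

variable {n : ℕ} {g : ℝ → Fin n → ℝ}

theorem l1Gain_ne_top (hg : IntegrableOn g (Ioi 0)) : l1Gain g ≠ ∞ :=
  ne_of_lt <| (iSup_le fun i => lintegral_mono fun t =>
    enorm_le_iff_norm_le.2 (norm_le_pi_norm (g t) i)).trans_lt hg.hasFiniteIntegral

theorem integral_norm_le_toReal_l1Gain (hg : IntegrableOn g (Ioi 0)) (i : Fin n) :
    ∫ t in Ioi (0 : ℝ), ‖g t i‖ ≤ (l1Gain g).toReal := by
  rw [← ENNReal.ofReal_le_iff_le_toReal (l1Gain_ne_top hg),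
    ofReal_integral_norm_eq_lintegral_enorm (hg.eval i)]
  exact le_iSup (fun i => ∫⁻ t in Ioi (0 : ℝ), ‖g t i‖ₑ) i

theorem conv_apply (hg : ContinuousOn g (Ici 0)) {v : ℝ → ℝ} (hv : ContinuousOn v (Ici 0)) {t : ℝ}
    (ht : 0 ≤ t) (i : Fin n) : conv g v t i = conv (fun s => g s i) v t :=
  map_conv (ContinuousLinearMap.proj i) hg hv ht

theorem norm_conv_le_toReal_l1Gain_mul (hgc : ContinuousOn g (Ici 0))
    (hg : IntegrableOn g (Ioi 0)) {v : ℝ → ℝ} (hv : ContinuousOn v (Ici 0)) {B t : ℝ}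
    (ht : 0 ≤ t) (hB : ∀ τ, 0 ≤ τ → τ ≤ t → |v τ| ≤ B) :
    ‖conv g v t‖ ≤ (l1Gain g).toReal * B := by
  have hB0 : 0 ≤ B := (abs_nonneg _).trans (hB 0 le_rfl ht)
  refine (pi_norm_le_iff_of_nonneg (by positivity)).2 fun i => ?_
  rw [conv_apply hgc hv ht i]
  exact (norm_conv_le (hg.eval i) ht hB).trans
    (mul_le_mul_of_nonneg_right (integral_norm_le_toReal_l1Gain hg i) hB0)

theorem eventually_norm_conv_le_toReal_l1Gain_mul_add (hgc : ContinuousOn g (Ici 0))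
    (hg : IntegrableOn g (Ioi 0)) {v : ℝ → ℝ} (hv : ContinuousOn v (Ici 0)) {η δ : ℝ}
    (hvη : ∀ᶠ t in atTop, |v t| ≤ η) (hδ : 0 < δ) :
    ∀ᶠ t in atTop, ‖conv g v t‖ ≤ (l1Gain g).toReal * η + δ := by
  have hη : 0 ≤ η := hvη.exists.elim fun _ h => (abs_nonneg _).trans h
  have hcoord : ∀ i, ∀ᶠ t in atTop, ‖conv (fun s => g s i) v t‖ ≤ (l1Gain g).toReal * η + δ :=
    fun i => (eventually_norm_conv_le (hg.eval i) (by fun_prop) hv hvη hδ).mono fun t ht =>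
      ht.trans (by gcongr; exact integral_norm_le_toReal_l1Gain hg i)
  filter_upwards [eventually_all.2 hcoord, eventually_ge_atTop 0] with t hall ht
  refine (pi_norm_le_iff_of_nonneg (by positivity)).2 fun i => ?_
  rw [conv_apply hgc hv ht i]
  exact hall i

theorem norm_le_of_conv_small_gain (hgc : ContinuousOn g (Ici 0)) (hg : IntegrableOn g (Ioi 0))
    {y d : ℝ → Fin n → ℝ} {p : ℝ → ℝ} (hy : ContinuousOn y (Ici 0)) (hp : ContinuousOn p (Ici 0))
    (hyd : ∀ t, 0 ≤ t → y t = d t + conv g p t) {a D : ℝ} (hd : ∀ t, 0 ≤ t → ‖d t‖ ≤ D)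
    (ha : 0 ≤ a) (hpy : ∀ t, 0 ≤ t → |p t| ≤ a * ‖y t‖) (hga : (l1Gain g).toReal * a < 1) {t : ℝ}
    (ht : 0 ≤ t) : ‖y t‖ ≤ D / (1 - (l1Gain g).toReal * a) := by
  refine norm_le_of_small_gain hy hga (fun t ht B hB => ?_) ht
  have hpB : ∀ τ, 0 ≤ τ → τ ≤ t → |p τ| ≤ a * B := fun τ hτ0 hτt =>
    (hpy τ hτ0).trans (mul_le_mul_of_nonneg_left (hB τ hτ0 hτt) ha)
  calc ‖y t‖ ≤ ‖d t‖ + ‖conv g p t‖ := hyd t ht ▸ norm_add_le _ _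
    _ ≤ D + (l1Gain g).toReal * (a * B) :=
        add_le_add (hd t ht) (norm_conv_le_toReal_l1Gain_mul hgc hg hp ht hpB)
    _ = D + (l1Gain g).toReal * a * B := by rw [mul_assoc]

theorem tendsto_zero_of_conv_small_gain (hgc : ContinuousOn g (Ici 0))
    (hg : IntegrableOn g (Ioi 0)) {y d : ℝ → Fin n → ℝ} {p : ℝ → ℝ} (hy : ContinuousOn y (Ici 0))
    (hp : ContinuousOn p (Ici 0)) (hyd : ∀ t, 0 ≤ t → y t = d t + conv g p t)
    (hd : ContinuousOn d (Ici 0)) (hd0 : Tendsto d atTop (𝓝 0)) {a : ℝ} (ha : 0 ≤ a)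
    (hpy : ∀ t, 0 ≤ t → |p t| ≤ a * ‖y t‖) (hga : (l1Gain g).toReal * a < 1) :
    Tendsto y atTop (𝓝 0) := by
  obtain ⟨D, hD⟩ := exists_norm_le_of_tendsto hd hd0
  refine tendsto_zero_of_small_gain ((eventually_ge_atTop 0).mono fun t ht =>
    norm_le_of_conv_small_gain hgc hg hy hp hyd hD ha hpy hga ht) hga fun η hη δ hδ => ?_
  have hpη : ∀ᶠ t in atTop, |p t| ≤ a * η := by
    filter_upwards [hη, eventually_ge_atTop 0] with t htη ht
    exact (hpy t ht).trans (mul_le_mul_of_nonneg_left htη ha)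
  filter_upwards [eventually_norm_conv_le_toReal_l1Gain_mul_add hgc hg hp hpη (half_pos hδ),
    hd0.norm.eventually_le_const (norm_zero.trans_lt (half_pos hδ)), eventually_ge_atTop 0]
    with t hconv hdt ht
  calc ‖y t‖ ≤ ‖d t‖ + ‖conv g p t‖ := hyd t ht ▸ norm_add_le _ _
    _ ≤ δ / 2 + ((l1Gain g).toReal * (a * η) + δ / 2) := add_le_add hdt hconv
    _ = (l1Gain g).toReal * a * η + δ := by ring

theorem toReal_l1Gain_mul_lt_one {a : ℝ} (ha : 0 ≤ a) (h : l1Gain g * ENNReal.ofReal a < 1) :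
    (l1Gain g).toReal * a < 1 := by
  simpa [ENNReal.toReal_mul, ENNReal.toReal_ofReal ha] using
    (ENNReal.toReal_lt_toReal (h.trans ENNReal.one_lt_top).ne ENNReal.one_ne_top).2 h

end L1Gain

section ThetaMax

variable {n : ℕ} {Ω : Set (Fin n → ℝ)}

theorem thetaMax_nonneg (Ω : Set (Fin n → ℝ)) : 0 ≤ thetaMax Ω :=
  Real.sSup_nonneg (forall_mem_image.2 fun _ _ => Finset.sum_nonneg fun _ _ => abs_nonneg _)

theorem abs_dotProduct_le_thetaMax_mul_norm (hΩ : IsCompact Ω) {ϑ : Fin n → ℝ} (hϑ : ϑ ∈ Ω)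
    (v : Fin n → ℝ) : |ϑ ⬝ᵥ v| ≤ thetaMax Ω * ‖v‖ :=
  calc |ϑ ⬝ᵥ v| ≤ ∑ i, |ϑ i * v i| := Finset.abs_sum_le_sum_abs _ _
    _ ≤ ∑ i, |ϑ i| * ‖v‖ := Finset.sum_le_sum fun i _ => by
        rw [abs_mul]
        exact mul_le_mul_of_nonneg_left (norm_le_pi_norm v i) (abs_nonneg _)
    _ = (∑ i, |ϑ i|) * ‖v‖ := (Finset.sum_mul _ _ _).symm
    _ ≤ thetaMax Ω * ‖v‖ := by
        gcongr
        exact le_csSup (hΩ.image (by fun_prop)).bddAbove (mem_image_of_mem _ hϑ)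

end ThetaMax

theorem integrableOn_const_dotProduct {α ι : Type*} [Fintype ι] [MeasurableSpace α]
    {μ : Measure α} {s : Set α} {f : α → ι → ℝ} (w : ι → ℝ) (hf : IntegrableOn f s μ) :
    IntegrableOn (fun a => w ⬝ᵥ f a) s μ :=
  integrable_finsetSum _ fun i _ => (hf.eval i).const_mul (w i)

theorem tendsto_const_dotProduct_zero {α ι : Type*} [Fintype ι] {l : Filter α} {f : α → ι → ℝ}
    (w : ι → ℝ) (hf : Tendsto f l (𝓝 0)) : Tendsto (fun a => w ⬝ᵥ f a) l (𝓝 0) := by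
  have hw : Continuous fun v : ι → ℝ => w ⬝ᵥ v := by fun_prop
  simpa [Function.comp_def] using (hw.tendsto 0).comp hf

namespace StrictlyProperSystem

/-- The derivative `t ↦ cᵀ A exp (t A) b` of the impulse response. -/
def impulseDeriv (C : StrictlyProperSystem) (t : ℝ) : ℝ :=
  C.c ⬝ᵥ (C.A *ᵥ stateImpulse C.A C.b t)

variable {C : StrictlyProperSystem}

theorem hasDerivAt_impulse (C : StrictlyProperSystem) (t : ℝ) :
    HasDerivAt C.impulse (C.impulseDeriv t) t :=
  (hasDerivAt_dotProduct (hasDerivAt_const t C.c)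
    (hasDerivAt_stateImpulse C.A C.b t)).congr_deriv (by simp [impulseDeriv])

theorem continuous_impulse (C : StrictlyProperSystem) : Continuous C.impulse :=
  continuous_iff_continuousAt.2 fun t => (C.hasDerivAt_impulse t).continuousAt

theorem continuous_impulseDeriv (C : StrictlyProperSystem) : Continuous C.impulseDeriv :=
  continuous_const.dotProduct (continuous_const.matrix_mulVec (continuous_stateImpulse C.A C.b))

theorem Stable.integrableOn_impulse (hC : C.Stable) : IntegrableOn C.impulse (Ioi 0) :=
  integrableOn_const_dotProduct C.c (IsHurwitz.integrableOn_stateImpulse hC C.b)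

theorem Stable.integrableOn_impulseDeriv (hC : C.Stable) :
    IntegrableOn C.impulseDeriv (Ioi 0) := by
  have h : C.impulseDeriv = fun t => (C.c ᵥ* C.A) ⬝ᵥ stateImpulse C.A C.b t :=
    funext fun t => Matrix.dotProduct_mulVec _ _ _
  exact h ▸ integrableOn_const_dotProduct _ (IsHurwitz.integrableOn_stateImpulse hC C.b)

theorem Stable.tendsto_impulse (hC : C.Stable) : Tendsto C.impulse atTop (𝓝 0) :=
  tendsto_const_dotProduct_zero C.c (IsHurwitz.tendsto_stateImpulse hC C.b)

theorem response_eq_conv (C : StrictlyProperSystem) (v : ℝ → ℝ) :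
    C.response v = conv C.impulse v := by
  funext t
  simp only [response, conv, smul_eq_mul, mul_comm]

-- Integration by parts moves the derivative onto the impulse response, whose derivative is
-- integrable because `C` is strictly proper.
theorem Stable.tendsto_conv_impulse_deriv (hC : C.Stable) {v v' : ℝ → ℝ}
    (hv : ∀ t, 0 ≤ t → HasDerivWithinAt v (v' t) (Ici 0) t) (hv' : ContinuousOn v' (Ici 0))
    (hv0 : Tendsto v atTop (𝓝 0)) : Tendsto (conv C.impulse v') atTop (𝓝 0) := by
  have hvc : ContinuousOn v (Ici 0) := fun t ht => (hv t ht).continuousWithinAt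
  have hlim : Tendsto (fun t => C.impulse 0 * v t - C.impulse t * v 0 + conv C.impulseDeriv v t)
      atTop (𝓝 0) := by
    simpa using ((hv0.const_mul _).sub (hC.tendsto_impulse.mul_const _)).add
      (tendsto_conv_zero hC.integrableOn_impulseDeriv hvc hv0)
  refine hlim.congr' ?_
  filter_upwards [eventually_ge_atTop 0] with t ht
  exact (conv_deriv C.hasDerivAt_impulse C.continuous_impulseDeriv hv hv' ht).symm

end StrictlyProperSystem

section GBar

variable {n : ℕ} {Am : Matrix (Fin n) (Fin n) ℝ} {b : Fin n → ℝ} {C : StrictlyProperSystem}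

theorem gBar_eqOn (Am : Matrix (Fin n) (Fin n) ℝ) (b : Fin n → ℝ) (C : StrictlyProperSystem) :
    EqOn (gBar Am b C) (conv (stateImpulse Am b) C.impulse - stateImpulse Am b) (Ici 0) := by
  intro t ht
  funext i
  rw [Pi.sub_apply, Pi.sub_apply, conv_apply (continuous_stateImpulse Am b).continuousOn
    C.continuous_impulse.continuousOn ht i]
  simp only [gBar, conv, smul_eq_mul, mul_comm]

theorem continuousOn_gBar : ContinuousOn (gBar Am b C) (Ici 0) :=
  ((continuousOn_conv (continuous_stateImpulse Am b).continuousOn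
    C.continuous_impulse.continuousOn).sub (continuous_stateImpulse Am b).continuousOn).congr
      (gBar_eqOn Am b C)

theorem IsHurwitz.integrableOn_gBar (hA : IsHurwitz Am) (b : Fin n → ℝ) (hC : C.Stable) :
    IntegrableOn (gBar Am b C) (Ioi 0) :=
  ((integrableOn_conv (hA.integrableOn_stateImpulse b) hC.integrableOn_impulse).sub
    (hA.integrableOn_stateImpulse b)).congr_fun
      (fun _ ht => (gBar_eqOn Am b C (Ioi_subset_Ici_self ht)).symm) measurableSet_Ioi

theorem conv_gBar {v : ℝ → ℝ} (hv : ContinuousOn v (Ici 0)) {t : ℝ} (ht : 0 ≤ t) :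
    conv (gBar Am b C) v t = conv (stateImpulse Am b) (conv C.impulse v - v) t := by
  have hH : ContinuousOn (stateImpulse Am b) (Ici 0) := (continuous_stateImpulse Am b).continuousOn
  have hh : ContinuousOn C.impulse (Ici 0) := C.continuous_impulse.continuousOn
  rw [conv_congr (gBar_eqOn Am b C) (fun _ _ => rfl) ht,
    conv_sub_left (continuousOn_conv hH hh) hH hv ht, ← conv_conv hH hh hv ht,
    conv_sub hH (continuousOn_conv hh hv) hv ht]

end GBar

section Response

variable {n : ℕ} {A : Matrix (Fin n) (Fin n) ℝ} {b : Fin n → ℝ} {C : StrictlyProperSystem}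

theorem eq_stateImpulse_add_conv_gBar {y : ℝ → Fin n → ℝ} {p ω : ℝ → ℝ}
    (hp : ContinuousOn p (Ici 0)) (hω : ContinuousOn ω (Ici 0))
    (hy : ∀ t, 0 ≤ t → HasDerivWithinAt y
      (A *ᵥ y t + (conv C.impulse p t - p t + ω t) • b) (Ici 0) t) {t : ℝ} (ht : 0 ≤ t) :
    y t = stateImpulse A (y 0) t + conv (stateImpulse A b) ω t + conv (gBar A b C) p t := by
  have hH : ContinuousOn (stateImpulse A b) (Ici 0) := (continuous_stateImpulse A b).continuousOn
  have hCp : ContinuousOn (conv C.impulse p - p) (Ici 0) :=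
    (continuousOn_conv C.continuous_impulse.continuousOn hp).sub hp
  rw [eq_stateImpulse_add_conv (hCp.add hω) hy ht, conv_add hH hCp hω ht, conv_gBar hp ht]
  abel

-- Pairing `e' = A e - q b` with a vector `w` such that `w ⬝ᵥ b = 1` expresses `q` through `e`,
-- which tends to zero, and the derivative of `w ⬝ᵥ e`.
theorem StrictlyProperSystem.Stable.tendsto_conv_impulse_of_hasDerivWithinAt (hC : C.Stable)
    (hb : b ≠ 0) {e : ℝ → Fin n → ℝ} {q : ℝ → ℝ} (hq : ContinuousOn q (Ici 0))
    (he : ∀ t, 0 ≤ t → HasDerivWithinAt e (A *ᵥ e t - q t • b) (Ici 0) t)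
    (he0 : Tendsto e atTop (𝓝 0)) : Tendsto (conv C.impulse q) atTop (𝓝 0) := by
  obtain ⟨w, hw⟩ : ∃ w : Fin n → ℝ, w ⬝ᵥ b = 1 :=
    ⟨(b ⬝ᵥ b)⁻¹ • b, by simp [inv_mul_cancel₀ (dotProduct_self_eq_zero.not.2 hb)]⟩
  have hec : ContinuousOn e (Ici 0) := fun t ht => (he t ht).continuousWithinAt
  let v : ℝ → ℝ := fun t => w ⬝ᵥ (A *ᵥ e t)
  have hv : ContinuousOn v (Ici 0) :=
    (by fun_prop : Continuous fun z : Fin n → ℝ => w ⬝ᵥ (A *ᵥ z)).comp_continuousOn hec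
  have hv0 : Tendsto v atTop (𝓝 0) := by
    simpa only [v, Matrix.dotProduct_mulVec] using tendsto_const_dotProduct_zero (w ᵥ* A) he0
  have hderiv : ∀ t, 0 ≤ t → HasDerivWithinAt (fun t => w ⬝ᵥ e t) ((v - q) t) (Ici 0) t :=
    fun t ht => (hasDerivWithinAt_dotProduct (hasDerivWithinAt_const t _ w)
      (he t ht)).congr_deriv (by simp [v, dotProduct_sub, hw])
  have hh : ContinuousOn C.impulse (Ici 0) := C.continuous_impulse.continuousOn
  have hlim := (tendsto_conv_zero hC.integrableOn_impulse hv hv0).sub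
    (hC.tendsto_conv_impulse_deriv hderiv (hv.sub hq) (tendsto_const_dotProduct_zero w he0))
  rw [sub_zero] at hlim
  refine hlim.congr' ?_
  filter_upwards [eventually_ge_atTop 0] with t ht
  rw [← conv_sub hh hv (hv.sub hq) ht, sub_sub_cancel]

end Response

theorem closedMatrix_mulVec {n : ℕ} (A : Matrix (Fin n) (Fin n) ℝ) (b K v : Fin n → ℝ) :
    closedMatrix A b K *ᵥ v = A *ᵥ v - (K ⬝ᵥ v) • b := by
  simp [closedMatrix, Matrix.sub_mulVec, Matrix.vecMulVec_mulVec]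

theorem IsPlantTrajectory.hasDerivWithinAt_closedMatrix {n : ℕ} {A : Matrix (Fin n) (Fin n) ℝ}
    {b θ K : Fin n → ℝ} {u : ℝ → ℝ} {x : ℝ → Fin n → ℝ} (hx : IsPlantTrajectory A b θ u x)
    {t v : ℝ} (ht : 0 ≤ t) (hu : u t = v - K ⬝ᵥ x t) :
    HasDerivWithinAt x (closedMatrix A b K *ᵥ x t + (v - θ ⬝ᵥ x t) • b) (Ici 0) t := by
  refine (hx t ht).congr_deriv ?_
  rw [closedMatrix_mulVec, hu]
  module

theorem absolutelyContinuousOnInterval_lyapunovFn {n : ℕ} (P : Matrix (Fin n) (Fin n) ℝ) (Γ : ℝ)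
    {e φ : ℝ → Fin n → ℝ} {s t : ℝ} (he : AbsolutelyContinuousOnInterval e s t)
    (hφ : AbsolutelyContinuousOnInterval φ s t) :
    AbsolutelyContinuousOnInterval (fun τ => lyapunovFn P Γ (e τ) (φ τ)) s t :=
  (absolutelyContinuousOnInterval_dotProduct he
    (absolutelyContinuousOnInterval_comp_of_lipschitzWith
      (LinearMap.toContinuousLinearMap P.mulVecLin).lipschitz he)).add
      ((absolutelyContinuousOnInterval_dotProduct hφ hφ).const_mul Γ⁻¹)

namespace IsAdaptiveClosedLoop

variable {n : ℕ} {A : Matrix (Fin n) (Fin n) ℝ} {b c K θ : Fin n → ℝ} {Ω : Set (Fin n → ℝ)}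
  {C : StrictlyProperSystem} {P Q : Matrix (Fin n) (Fin n) ℝ} {Γc : ℝ} {r : ℝ → ℝ}
  {x₀ θh₀ : Fin n → ℝ} {x xh θh : ℝ → Fin n → ℝ} {u u₂ : ℝ → ℝ}
  (hloop : IsAdaptiveClosedLoop A b c K θ Ω C P Γc r x₀ θh₀ x xh θh u u₂)

include hloop

theorem continuousOn_state : ContinuousOn x (Ici 0) :=
  fun t ht => (hloop.plant t ht).continuousWithinAt

theorem continuousOn_estimate : ContinuousOn θh (Ici 0) :=
  continuousOn_Ici_of_absolutelyContinuousOnInterval hloop.estimate_ac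

theorem continuousOn_estimate_sub_dotProduct (ϑ : Fin n → ℝ) :
    ContinuousOn (fun t => (θh t - ϑ) ⬝ᵥ x t) (Ici 0) :=
  continuousOn_dotProduct (hloop.continuousOn_estimate.sub continuousOn_const)
    hloop.continuousOn_state

theorem hasDerivWithinAt_error {t : ℝ} (ht : 0 ≤ t) :
    HasDerivWithinAt (fun t => xh t - x t)
      (closedMatrix A b K *ᵥ (xh t - x t) - ((θh t - θ) ⬝ᵥ x t) • b) (Ici 0) t := by
  have hx := hloop.plant.hasDerivWithinAt_closedMatrix ht
    ((hloop.control t ht).trans (neg_add_eq_sub _ _))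
  refine ((hloop.predictor t ht).sub hx).congr_deriv ?_
  rw [Matrix.mulVec_sub, sub_dotProduct]
  module

theorem continuousOn_error : ContinuousOn (fun t => xh t - x t) (Ici 0) :=
  fun _ ht => (hloop.hasDerivWithinAt_error ht).continuousWithinAt

theorem estimate_mem (hΩ : Convex ℝ Ω) (hΩc : IsClosed Ω) (hΓ : 0 ≤ Γc) (hθh₀ : θh₀ ∈ Ω) {t : ℝ}
    (ht : 0 ≤ t) : θh t ∈ Ω := by
  refine mem_of_ae_hasDerivAt_mem_dirCone hΩ hΩc ht (hloop.estimate_ac t ht)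
    (hloop.estimate_init ▸ hθh₀) ?_
  filter_upwards [hloop.estimate] with τ hderiv hτ
  refine ⟨_, ?_, hderiv hτ.1⟩
  refine map_mem_closure (continuous_const_smul Γc) (isNearest_proj hΩ ⟨θh₀, hθh₀⟩ _ _).1 ?_
  rintro _ ⟨z, hz, a, ha, rfl⟩
  exact ⟨z, hz, Γc * a, mul_nonneg hΓ ha, (mul_smul _ _ _).symm⟩

theorem absolutelyContinuousOnInterval_error {t : ℝ} (ht : 0 ≤ t) :
    AbsolutelyContinuousOnInterval (fun τ => xh τ - x τ) 0 t := by
  have he := hloop.continuousOn_error.mono (Icc_subset_Ici_self (a := t) (b := 0))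
  have hq := (hloop.continuousOn_estimate_sub_dotProduct θ).mono
    (Icc_subset_Ici_self (a := t) (b := 0))
  exact absolutelyContinuousOnInterval_of_hasDerivWithinAt_Icc ht
    (fun τ hτ => (hloop.hasDerivWithinAt_error hτ.1).mono Icc_subset_Ici_self)
    (((by fun_prop : Continuous fun v => closedMatrix A b K *ᵥ v).comp_continuousOn he).sub
      (hq.smul continuousOn_const))

theorem ae_le_of_hasDerivAt_lyapunovFn (hΩ : Convex ℝ Ω) (hθ : θ ∈ Ω) (hPs : P.IsSymm)
    (hP : (closedMatrix A b K)ᵀ * P + P * closedMatrix A b K = -Q) (hΓ : 0 < Γc) :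
    ∀ᵐ t, 0 < t → ∀ d, HasDerivAt (fun τ => lyapunovFn P Γc (xh τ - x τ) (θh τ - θ)) d t →
      d ≤ -((xh t - x t) ⬝ᵥ (Q *ᵥ (xh t - x t))) := by
  filter_upwards [hloop.estimate] with t hestimate ht d hd
  have herror := (hloop.hasDerivWithinAt_error ht.le).hasDerivAt (Ici_mem_nhds ht)
  have hderiv := hasDerivAt_lyapunovFn hPs Γc herror ((hestimate ht).sub_const θ)
  exact (hd.unique hderiv).trans_le (lyapunov_rate_le hPs hP hΩ hθ hΓ)

theorem lyapunovFn_sub_le (hΩ : Convex ℝ Ω) (hθ : θ ∈ Ω) (hPs : P.IsSymm)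
    (hP : (closedMatrix A b K)ᵀ * P + P * closedMatrix A b K = -Q) (hΓ : 0 < Γc) {t : ℝ}
    (ht : 0 ≤ t) :
    lyapunovFn P Γc (xh t - x t) (θh t - θ) - lyapunovFn P Γc (xh 0 - x 0) (θh 0 - θ) ≤
      -∫ τ in (0 : ℝ)..t, (xh τ - x τ) ⬝ᵥ (Q *ᵥ (xh τ - x τ)) := by
  have hquad : ContinuousOn (fun τ => -((xh τ - x τ) ⬝ᵥ (Q *ᵥ (xh τ - x τ)))) (Icc 0 t) :=
    (by fun_prop : Continuous fun v : Fin n → ℝ => -(v ⬝ᵥ (Q *ᵥ v))).comp_continuousOn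
      (hloop.continuousOn_error.mono Icc_subset_Ici_self)
  have hestimate : AbsolutelyContinuousOnInterval (fun τ => θh τ - θ) 0 t :=
    absolutelyContinuousOnInterval_comp_of_lipschitzWith
      (IsometryEquiv.subRight θ).isometry.lipschitz (hloop.estimate_ac t ht)
  rw [← intervalIntegral.integral_neg]
  refine sub_le_integral_of_absolutelyContinuousOnInterval ht
    (absolutelyContinuousOnInterval_lyapunovFn P Γc
      (hloop.absolutelyContinuousOnInterval_error ht) hestimate)
    (hquad.intervalIntegrable_of_Icc ht) ?_
  filter_upwards [hloop.ae_le_of_hasDerivAt_lyapunovFn hΩ hθ hPs hP hΓ] with τ hle hτ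
  exact hle hτ.1

end IsAdaptiveClosedLoop

-- Barbalat's argument for the dissipation rate `eᵀ Q e`.
theorem tendsto_zero_of_integrableOn_posDef {ι : Type*} [Fintype ι] {Q : Matrix ι ι ℝ}
    (hQ : Q.PosDef) {e e' : ℝ → ι → ℝ} {a B B' : ℝ} (he : ∀ t, a < t → HasDerivAt e (e' t) t)
    (heB : ∀ t, a < t → ‖e t‖ ≤ B) (heB' : ∀ t, a < t → ‖e' t‖ ≤ B')
    (hint : IntegrableOn (fun t => e t ⬝ᵥ (Q *ᵥ e t)) (Ioi a)) : Tendsto e atTop (𝓝 0) := by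
  obtain ⟨c, hc, hcQ⟩ := exists_pos_mul_norm_sq_le_of_posDef hQ
  let F : (ι → ℝ) × (ι → ℝ) → ℝ := fun z => z.1 ⬝ᵥ (Q *ᵥ z.1)
  let F' : (ι → ℝ) × (ι → ℝ) → ℝ := fun z => z.1 ⬝ᵥ (Q *ᵥ z.2) + z.2 ⬝ᵥ (Q *ᵥ z.1)
  have hcompact := (isCompact_closedBall (0 : ι → ℝ) B).prod (isCompact_closedBall (0 : ι → ℝ) B')
  have hmem : ∀ t, a < t → (e t, e' t) ∈ Metric.closedBall 0 B ×ˢ Metric.closedBall 0 B' :=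
    fun t ht => ⟨mem_closedBall_zero_iff.2 (heB t ht), mem_closedBall_zero_iff.2 (heB' t ht)⟩
  obtain ⟨R, hR⟩ := hcompact.exists_bound_of_continuousOn
    (by fun_prop : Continuous F).continuousOn
  obtain ⟨R', hR'⟩ := hcompact.exists_bound_of_continuousOn
    (by fun_prop : Continuous F').continuousOn
  have hrate : Tendsto (fun t => e t ⬝ᵥ (Q *ᵥ e t)) atTop (𝓝 0) :=
    tendsto_zero_of_integrableOn_of_bounded_deriv (f' := fun t => F' (e t, e' t))
      (fun t ht => (hasDerivWithinAt_dotProduct_mulVec Q (he t ht).hasDerivWithinAt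
        (he t ht).hasDerivWithinAt).hasDerivAt univ_mem)
      (fun t ht => hR _ (hmem t ht)) (fun t ht => hR' _ (hmem t ht)) hint
  have hsq : Tendsto (fun t => ‖e t‖ ^ 2) atTop (𝓝 0) := by
    refine squeeze_zero (fun t => by positivity) (fun t => ?_) (by simpa using hrate.const_mul c⁻¹)
    exact (le_inv_mul_iff₀ hc).2 (hcQ (e t))
  rw [tendsto_zero_iff_norm_tendsto_zero]
  simpa [Real.sqrt_sq] using hsq.sqrt

theorem transferFn_zero_left {n : ℕ} (A : Matrix (Fin n) (Fin n) ℝ) (c : Fin n → ℝ) (s : ℝ) :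
    transferFn A 0 c s = 0 := by
  simp [transferFn]

namespace IsAdaptiveClosedLoop

variable {n : ℕ} {A : Matrix (Fin n) (Fin n) ℝ} {b c K θ : Fin n → ℝ} {Ω : Set (Fin n → ℝ)}
  {C : StrictlyProperSystem} {P Q : Matrix (Fin n) (Fin n) ℝ} {Γc : ℝ} {r : ℝ → ℝ}
  {x₀ θh₀ : Fin n → ℝ} {x xh θh : ℝ → Fin n → ℝ} {u u₂ : ℝ → ℝ}
  (hloop : IsAdaptiveClosedLoop A b c K θ Ω C P Γc r x₀ θh₀ x xh θh u u₂)

include hloop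

section Error

variable (hΩ : Convex ℝ Ω) (hθ : θ ∈ Ω) (hK : IsHurwitz (closedMatrix A b K)) (hQ : Q.PosDef)
  (hP : (closedMatrix A b K)ᵀ * P + P * closedMatrix A b K = -Q) (hΓ : 0 < Γc)

include hΩ hθ hK hQ hP hΓ

theorem exists_norm_error_le : ∃ E, ∀ t, 0 ≤ t → ‖xh t - x t‖ ≤ E := by
  obtain ⟨p, hp, hpP⟩ := exists_pos_mul_norm_sq_le_of_posDef (hK.posDef_of_lyapunov hQ hP)
  let V : ℝ → ℝ := fun t => lyapunovFn P Γc (xh t - x t) (θh t - θ)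
  have hPs := hK.isSymm_of_lyapunov (Matrix.isHermitian_iff_isSymm.1 hQ.isHermitian) hP
  refine ⟨√(V 0 / p), fun t ht => Real.le_sqrt_of_sq_le ((le_div_iff₀' hp).2 ?_)⟩
  have hrate : 0 ≤ ∫ τ in (0 : ℝ)..t, (xh τ - x τ) ⬝ᵥ (Q *ᵥ (xh τ - x τ)) :=
    intervalIntegral.integral_nonneg ht fun τ _ => hQ.posSemidef.dotProduct_mulVec_nonneg _
  calc p * ‖xh t - x t‖ ^ 2 ≤ V t := (hpP _).trans (le_lyapunovFn hΓ.le _ _)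
    _ ≤ V 0 := sub_nonpos.1 ((hloop.lyapunovFn_sub_le hΩ hθ hPs hP hΓ ht).trans
      (neg_nonpos.2 hrate))

theorem integrableOn_error_dotProduct_mulVec :
    IntegrableOn (fun t => (xh t - x t) ⬝ᵥ (Q *ᵥ (xh t - x t))) (Ioi 0) := by
  have hPs := hK.isSymm_of_lyapunov (Matrix.isHermitian_iff_isSymm.1 hQ.isHermitian) hP
  have hPpos := (hK.posDef_of_lyapunov hQ hP).posSemidef
  exact integrableOn_Ioi_of_sub_le_neg_integral
    (V := fun t => lyapunovFn P Γc (xh t - x t) (θh t - θ))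
    ((by fun_prop : Continuous fun v : Fin n → ℝ => v ⬝ᵥ (Q *ᵥ v)).comp_continuousOn
      hloop.continuousOn_error)
    (fun t _ => hQ.posSemidef.dotProduct_mulVec_nonneg _)
    (fun t _ => (hPpos.dotProduct_mulVec_nonneg _).trans (le_lyapunovFn hΓ.le _ _))
    (fun t ht => hloop.lyapunovFn_sub_le hΩ hθ hPs hP hΓ ht)

theorem tendsto_error (hΩc : IsCompact Ω) (hθh₀ : θh₀ ∈ Ω)
    (hx : ∃ X, ∀ t, 0 ≤ t → ‖x t‖ ≤ X) : Tendsto (fun t => xh t - x t) atTop (𝓝 0) := by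
  obtain ⟨X, hX⟩ := hx
  obtain ⟨E, hE⟩ := hloop.exists_norm_error_le hΩ hθ hK hQ hP hΓ
  have hcompact := (isCompact_closedBall (0 : Fin n → ℝ) E).prod
    (hΩc.prod (isCompact_closedBall (0 : Fin n → ℝ) X))
  let F : (Fin n → ℝ) × (Fin n → ℝ) × (Fin n → ℝ) → Fin n → ℝ := fun z =>
    closedMatrix A b K *ᵥ z.1 - ((z.2.1 - θ) ⬝ᵥ z.2.2) • b
  obtain ⟨E', hE'⟩ := hcompact.exists_bound_of_continuousOn
    (by fun_prop : Continuous F).continuousOn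
  refine tendsto_zero_of_integrableOn_posDef hQ (B := E) (B' := E')
    (fun t ht => (hloop.hasDerivWithinAt_error ht.le).hasDerivAt (Ici_mem_nhds ht))
    (fun t ht => hE t ht.le) (fun t ht => hE' (xh t - x t, θh t, x t) ⟨?_, ?_, ?_⟩)
    (hloop.integrableOn_error_dotProduct_mulVec hΩ hθ hK hQ hP hΓ)
  · exact mem_closedBall_zero_iff.2 (hE t ht.le)
  · exact hloop.estimate_mem hΩ hΩc.isClosed hΓ.le hθh₀ ht.le
  · exact mem_closedBall_zero_iff.2 (hX t ht.le)

end Error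

theorem filter_eq_conv_add (hr : ContinuousOn r (Ici 0)) {t : ℝ} (ht : 0 ≤ t) :
    u₂ t = conv C.impulse (fun τ => θh τ ⬝ᵥ x τ) t +
      conv C.impulse (fun τ => kg (closedMatrix A b K) b c * r τ) t := by
  rw [hloop.filter t ht, C.response_eq_conv]
  exact conv_add C.continuous_impulse.continuousOn
    (continuousOn_dotProduct hloop.continuousOn_estimate hloop.continuousOn_state)
    (hr.const_mul _) ht

theorem predictor_eq (hr : ContinuousOn r (Ici 0)) {t : ℝ} (ht : 0 ≤ t) :
    xh t = stateImpulse (closedMatrix A b K) (xh 0) t +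
      conv (stateImpulse (closedMatrix A b K) b)
        (conv C.impulse fun τ => kg (closedMatrix A b K) b c * r τ) t +
      conv (gBar (closedMatrix A b K) b C) (fun τ => θh τ ⬝ᵥ x τ) t := by
  refine eq_stateImpulse_add_conv_gBar
    (continuousOn_dotProduct hloop.continuousOn_estimate hloop.continuousOn_state)
    (continuousOn_conv C.continuous_impulse.continuousOn (hr.const_mul _)) (fun τ hτ => ?_) ht
  refine (hloop.predictor τ hτ).congr_deriv ?_
  rw [hloop.filter_eq_conv_add hr hτ]
  module

theorem exists_norm_state_le (hΩc : IsCompact Ω) (hθh : ∀ t, 0 ≤ t → θh t ∈ Ω)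
    (hr : ContinuousOn r (Ici 0)) (hrb : ∃ M, ∀ t, 0 ≤ t → |r t| ≤ M)
    (hK : IsHurwitz (closedMatrix A b K)) (hC : C.Stable)
    (hgain : (l1Gain (gBar (closedMatrix A b K) b C)).toReal * thetaMax Ω < 1)
    (he : ∃ E, ∀ t, 0 ≤ t → ‖xh t - x t‖ ≤ E) : ∃ X, ∀ t, 0 ≤ t → ‖x t‖ ≤ X := by
  obtain ⟨M, hM⟩ := hrb
  obtain ⟨E, hE⟩ := he
  set Am := closedMatrix A b K
  let ω : ℝ → ℝ := conv C.impulse fun τ => kg Am b c * r τ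
  obtain ⟨B, hB⟩ := exists_norm_le_of_tendsto (a := 0)
    (continuous_stateImpulse Am (xh 0)).continuousOn (hK.tendsto_stateImpulse (xh 0))
  have hω : ∀ t, 0 ≤ t → |ω t| ≤ (∫ s in Ioi (0 : ℝ), ‖C.impulse s‖) * (|kg Am b c| * M) :=
    fun t ht => norm_conv_le hC.integrableOn_impulse ht fun τ hτ _ =>
      (abs_mul _ _).trans_le (mul_le_mul_of_nonneg_left (hM τ hτ) (abs_nonneg _))
  have hforced := fun t (ht : 0 ≤ t) =>
    norm_conv_le (hK.integrableOn_stateImpulse b) ht fun τ hτ _ => hω τ hτ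
  refine ⟨_, fun t ht => norm_le_of_conv_small_gain continuousOn_gBar (hK.integrableOn_gBar b hC)
    hloop.continuousOn_state
    (continuousOn_dotProduct hloop.continuousOn_estimate hloop.continuousOn_state)
    (d := fun t => stateImpulse Am (xh 0) t + conv (stateImpulse Am b) ω t - (xh t - x t))
    (fun t ht => ?_)
    (fun t ht => norm_sub_le_of_le (norm_add_le_of_le (hB t ht) (hforced t ht)) (hE t ht))
    (thetaMax_nonneg Ω) (fun t ht => abs_dotProduct_le_thetaMax_mul_norm hΩc (hθh t ht) _)
    hgain ht⟩
  have hpredictor := hloop.predictor_eq hr ht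
  rw [← sub_eq_iff_eq_add.2 hpredictor]
  abel

theorem tendsto_conv_impulse_estimate_sub_dotProduct (hC : C.Stable) (hb : b ≠ 0)
    (he0 : Tendsto (fun t => xh t - x t) atTop (𝓝 0)) :
    Tendsto (conv C.impulse fun t => (θh t - θ) ⬝ᵥ x t) atTop (𝓝 0) :=
  hC.tendsto_conv_impulse_of_hasDerivWithinAt hb (hloop.continuousOn_estimate_sub_dotProduct θ)
    (fun _ ht => hloop.hasDerivWithinAt_error ht) he0

end IsAdaptiveClosedLoop

section ReferenceSystem

variable {n : ℕ} {A : Matrix (Fin n) (Fin n) ℝ} {b c K θ : Fin n → ℝ} {Ω : Set (Fin n → ℝ)}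
  {C : StrictlyProperSystem} {P : Matrix (Fin n) (Fin n) ℝ} {Γc : ℝ} {r : ℝ → ℝ}
  {x₀ θh₀ : Fin n → ℝ} {x xh θh xref : ℝ → Fin n → ℝ} {u u₂ uref : ℝ → ℝ}

namespace IsReferenceClosedLoop

variable (href : IsReferenceClosedLoop A b c K θ C r xref uref)

include href

theorem continuousOn_state : ContinuousOn xref (Ici 0) :=
  fun t ht => (href.plant t ht).continuousWithinAt

theorem continuousOn_dotProduct_state (w : Fin n → ℝ) :
    ContinuousOn (fun t => w ⬝ᵥ xref t) (Ici 0) :=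
  continuousOn_dotProduct continuousOn_const href.continuousOn_state

theorem control_eq_conv_add_sub (hr : ContinuousOn r (Ici 0)) {t : ℝ} (ht : 0 ≤ t) :
    uref t = conv C.impulse (fun τ => kg (closedMatrix A b K) b c * r τ) t +
      conv C.impulse (fun τ => θ ⬝ᵥ xref τ) t - K ⬝ᵥ xref t := by
  rw [href.control t ht, C.response_eq_conv]
  exact congrArg (· - K ⬝ᵥ xref t) (conv_add C.continuous_impulse.continuousOn
    (hr.const_mul _) (href.continuousOn_dotProduct_state θ) ht)

end IsReferenceClosedLoop

namespace IsAdaptiveClosedLoop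

variable (hloop : IsAdaptiveClosedLoop A b c K θ Ω C P Γc r x₀ θh₀ x xh θh u u₂)
  (href : IsReferenceClosedLoop A b c K θ C r xref uref)

include hloop href

theorem continuousOn_dotProduct_sub_reference (w : Fin n → ℝ) :
    ContinuousOn (fun t => w ⬝ᵥ (x t - xref t)) (Ici 0) :=
  continuousOn_dotProduct continuousOn_const (hloop.continuousOn_state.sub href.continuousOn_state)

theorem control_sub_reference (hr : ContinuousOn r (Ici 0)) {t : ℝ} (ht : 0 ≤ t) :
    u t - uref t = conv C.impulse (fun τ => θ ⬝ᵥ (x τ - xref τ)) t +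
      conv C.impulse (fun τ => (θh τ - θ) ⬝ᵥ x τ) t - K ⬝ᵥ (x t - xref t) := by
  have hh : ContinuousOn C.impulse (Ici 0) := C.continuous_impulse.continuousOn
  have hp := hloop.continuousOn_dotProduct_sub_reference href θ
  have hq := hloop.continuousOn_estimate_sub_dotProduct θ
  have hsplit : conv C.impulse (fun τ => θh τ ⬝ᵥ x τ) t =
      conv C.impulse (fun τ => θ ⬝ᵥ (x τ - xref τ)) t +
        conv C.impulse (fun τ => (θh τ - θ) ⬝ᵥ x τ) t +
          conv C.impulse (fun τ => θ ⬝ᵥ xref τ) t := by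
    rw [← conv_add hh hp hq ht,
      ← conv_add hh (hp.add hq) (href.continuousOn_dotProduct_state θ) ht]
    refine conv_congr (fun _ _ => rfl) (fun τ _ => ?_) ht
    simp only [Pi.add_apply, sub_dotProduct, dotProduct_sub]
    ring
  rw [hloop.control t ht, hloop.filter_eq_conv_add hr ht, href.control_eq_conv_add_sub hr ht,
    hsplit, dotProduct_sub]
  ring

theorem hasDerivWithinAt_sub_reference (hr : ContinuousOn r (Ici 0)) {t : ℝ} (ht : 0 ≤ t) :
    HasDerivWithinAt (fun t => x t - xref t)
      (closedMatrix A b K *ᵥ (x t - xref t) +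
        (conv C.impulse (fun τ => θ ⬝ᵥ (x τ - xref τ)) t - θ ⬝ᵥ (x t - xref t) +
          conv C.impulse (fun τ => (θh τ - θ) ⬝ᵥ x τ) t) • b) (Ici 0) t := by
  have hcontrol := hloop.control_sub_reference href hr ht
  refine ((hloop.plant t ht).sub (href.plant t ht)).congr_deriv ?_
  rw [closedMatrix_mulVec, Matrix.mulVec_sub, sub_eq_iff_eq_add.1 hcontrol, dotProduct_sub θ]
  module

theorem tendsto_sub_reference (hΩc : IsCompact Ω) (hθ : θ ∈ Ω) (hr : ContinuousOn r (Ici 0))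
    (hK : IsHurwitz (closedMatrix A b K)) (hC : C.Stable)
    (hgain : (l1Gain (gBar (closedMatrix A b K) b C)).toReal * thetaMax Ω < 1)
    (hω0 : Tendsto (conv C.impulse fun t => (θh t - θ) ⬝ᵥ x t) atTop (𝓝 0)) :
    Tendsto (fun t => x t - xref t) atTop (𝓝 0) := by
  have hp := hloop.continuousOn_dotProduct_sub_reference href θ
  have hω := continuousOn_conv C.continuous_impulse.continuousOn
    (hloop.continuousOn_estimate_sub_dotProduct θ)
  have hd0 := (hK.tendsto_stateImpulse (x 0 - xref 0)).add
    (tendsto_conv_zero (hK.integrableOn_stateImpulse b) hω hω0)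
  rw [add_zero] at hd0
  exact tendsto_zero_of_conv_small_gain continuousOn_gBar (hK.integrableOn_gBar b hC)
    (hloop.continuousOn_state.sub href.continuousOn_state) hp
    (fun t ht => eq_stateImpulse_add_conv_gBar hp hω
      (fun τ hτ => hloop.hasDerivWithinAt_sub_reference href hr hτ) ht)
    ((continuous_stateImpulse _ _).continuousOn.add
      (continuousOn_conv (continuous_stateImpulse _ b).continuousOn hω))
    hd0 (thetaMax_nonneg Ω) (fun t _ => abs_dotProduct_le_thetaMax_mul_norm hΩc hθ _) hgain

theorem tendsto_control_sub_reference (hr : ContinuousOn r (Ici 0)) (hC : C.Stable)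
    (hω0 : Tendsto (conv C.impulse fun t => (θh t - θ) ⬝ᵥ x t) atTop (𝓝 0))
    (hy0 : Tendsto (fun t => x t - xref t) atTop (𝓝 0)) :
    Tendsto (fun t => u t - uref t) atTop (𝓝 0) := by
  have hp0 := tendsto_conv_zero hC.integrableOn_impulse
    (hloop.continuousOn_dotProduct_sub_reference href θ) (tendsto_const_dotProduct_zero θ hy0)
  have hlim := (hp0.add hω0).sub (tendsto_const_dotProduct_zero K hy0)
  rw [add_zero, sub_zero] at hlim
  refine hlim.congr' ?_
  filter_upwards [eventually_ge_atTop 0] with t ht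
  exact (hloop.control_sub_reference href hr ht).symm

end IsAdaptiveClosedLoop

end ReferenceSystem

end L1Adaptive

end

open L1Adaptive in
theorem theorem2_general {n : ℕ} (A : Matrix (Fin n) (Fin n) ℝ) (b c : Fin n → ℝ)
    (Ω : Set (Fin n → ℝ)) (hΩc : IsCompact Ω) (hΩ : Convex ℝ Ω) (θ : Fin n → ℝ) (hθ : θ ∈ Ω)
    (x₀ : Fin n → ℝ) (r : ℝ → ℝ) (hr : ContinuousOn r (Ici 0))
    (hrb : ∃ M, ∀ t, 0 ≤ t → |r t| ≤ M) (K : Fin n → ℝ) (hK : IsHurwitz (closedMatrix A b K))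
    (hkg : transferFn (closedMatrix A b K) b c 0 ≠ 0) (C : StrictlyProperSystem) (hC : C.Stable)
    (P Q : Matrix (Fin n) (Fin n) ℝ) (hQ : Q.PosDef)
    (hP : (closedMatrix A b K)ᵀ * P + P * closedMatrix A b K = -Q) (Γc : ℝ) (hΓ : 0 < Γc)
    (θh₀ : Fin n → ℝ) (hθh₀ : θh₀ ∈ Ω)
    (hgain : l1Gain (gBar (closedMatrix A b K) b C) * ENNReal.ofReal (thetaMax Ω) < 1)
    (x xh θh : ℝ → Fin n → ℝ) (u u₂ : ℝ → ℝ)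
    (hloop : IsAdaptiveClosedLoop A b c K θ Ω C P Γc r x₀ θh₀ x xh θh u u₂)
    (xref : ℝ → Fin n → ℝ) (uref : ℝ → ℝ) (href : IsReferenceClosedLoop A b c K θ C r xref uref) :
    Tendsto (fun t => ‖(WithLp.toLp 2 (x t - xref t) : EuclideanSpace ℝ (Fin n))‖) atTop (𝓝 0) ∧
      Tendsto (fun t => |u t - uref t|) atTop (𝓝 0) := by
  have hb : b ≠ 0 := by
    rintro rfl
    exact hkg (transferFn_zero_left _ _ _)
  have hgain_real := toReal_l1Gain_mul_lt_one (thetaMax_nonneg Ω) hgain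
  have hθh : ∀ t, 0 ≤ t → θh t ∈ Ω :=
    fun t => hloop.estimate_mem hΩ hΩc.isClosed hΓ.le hθh₀
  have herror := hloop.exists_norm_error_le hΩ hθ hK hQ hP hΓ
  have hstate := hloop.exists_norm_state_le hΩc hθh hr hrb hK hC hgain_real herror
  have herror0 := hloop.tendsto_error hΩ hθ hK hQ hP hΓ hΩc hθh₀ hstate
  have hfiltered0 := hloop.tendsto_conv_impulse_estimate_sub_dotProduct hC hb herror0
  have hy0 := hloop.tendsto_sub_reference href hΩc hθ hr hK hC hgain_real hfiltered0
  have hnorm : Continuous fun v : Fin n → ℝ => ‖(WithLp.toLp 2 v : EuclideanSpace ℝ (Fin n))‖ := by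
    fun_prop
  constructor
  · simpa [Function.comp_def] using (hnorm.tendsto 0).comp hy0
  · simpa using (hloop.tendsto_control_sub_reference href hr hC hfiltered0 hy0).abs

theorem theorem2 {n : ℕ}
    -- the plant
    (A : Matrix (Fin n) (Fin n) ℝ) (b c : Fin n → ℝ) (hAb : L1Adaptive.IsControllable A b)
    (Ω : Set (Fin n → ℝ)) (hΩc : IsCompact Ω) (hΩ : Convex ℝ Ω)
    (θ : Fin n → ℝ) (hθ : θ ∈ Ω) (x₀ : Fin n → ℝ)
    -- the reference input
    (r : ℝ → ℝ) (hr : ContinuousOn r (Ici 0)) (hrb : ∃ M, ∀ t, 0 ≤ t → |r t| ≤ M)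
    -- the design parameters of the controller
    (K : Fin n → ℝ) (hK : L1Adaptive.IsHurwitz (L1Adaptive.closedMatrix A b K))
    (hkg : L1Adaptive.transferFn (L1Adaptive.closedMatrix A b K) b c 0 ≠ 0)
    (C : L1Adaptive.StrictlyProperSystem) (hC : C.Stable) (hC0 : C.transfer 0 = 1)
    (P Q : Matrix (Fin n) (Fin n) ℝ) (hQ : Q.PosDef)
    (hP : (L1Adaptive.closedMatrix A b K)ᵀ * P + P * L1Adaptive.closedMatrix A b K = -Q)
    (Γc : ℝ) (hΓ : 0 < Γc) (θh₀ : Fin n → ℝ) (hθh₀ : θh₀ ∈ Ω)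
    -- the gain requirement
    (hgain : L1Adaptive.l1Gain (L1Adaptive.gBar (L1Adaptive.closedMatrix A b K) b C)
      * ENNReal.ofReal (L1Adaptive.thetaMax Ω) < 1)
    -- the adaptive closed loop and the reference system
    (x xh θh : ℝ → Fin n → ℝ) (u u₂ : ℝ → ℝ)
    (hloop : L1Adaptive.IsAdaptiveClosedLoop A b c K θ Ω C P Γc r x₀ θh₀ x xh θh u u₂)
    (xref : ℝ → Fin n → ℝ) (uref : ℝ → ℝ)
    (href : L1Adaptive.IsReferenceClosedLoop A b c K θ C r xref uref) :
    Tendsto (fun t => ‖(WithLp.toLp 2 (x t - xref t) : EuclideanSpace ℝ (Fin n))‖) atTop (𝓝 0) ∧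
      Tendsto (fun t => |u t - uref t|) atTop (𝓝 0) :=
  theorem2_general A b c Ω hΩc hΩ θ hθ x₀ r hr hrb K hK hkg C hC P Q hQ hP Γc hΓ θh₀ hθh₀ hgain
    x xh θh u u₂ hloop xref uref href
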